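/- Let $k$ be a field, let $\ell \ge 7$ be an integer with $\gcd(3,\ell)=1$, and let $A = k[[t^3, t^\ell]] \subseteq k[[t]]$, i.e. the ring of all power series in $t$ whose exponents lie in the numerical semigroup $\langle 3,\ell\rangle$. Then $A$ is a one-dimensional Cohen–Macaulay local ring with maximal ideal $\mathfrak m=(t^3,t^\ell)$. An $\mathfrak m$-primary ideal $I$ of $A$ is called an *Ulrich ideal* if it contains a parameter ideal $Q$ (an $\mathfrak m$-primary principal ideal) with $I \neq Q$ and $I^2 = QI$, and if $I/I^2$ is a free $A/I$-module. Let $\mathcal X_A$ be the set of Ulrich ideals of $A$. For $q \ge 0$ put $$\mathcal S_q = \left\{\left(t^{6i}+\alpha_0t^{\ell}+\alpha_1t^{\ell+3}+\cdots+\alpha_{i-1}t^{\ell+3(i-1)},\ t^{\ell+3i}\right) \;\middle|\; 1\le i\le q,\ \alpha_0,\dots,\alpha_{i-1}\in k,\ \alpha_0\ne 0\right\},$$ and for $d\in\{1,2\}$ with $3 \mid \ell+d$ put $$\mathcal F_{d,q} = \left\{\left(t^{\ell}+\sum_{j=1}^{q}\alpha_j t^{\ell+d+3(j-1)},\ t^{\ell+3q+d}\right)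 \;\middle|\; \alpha_1,\dots,\alpha_q\in k\right\}.$$ The following assertions hold. 1. If $\ell=3n+1$ with $n$ odd and $q=\frac{n-1}{2}$, then $\mathcal X_A=\mathcal F_{2,q}\cup\mathcal S_q$; that is, the members of the first family are the ideals $(t^{\ell}+\alpha_1t^{\ell+2}+\alpha_2t^{\ell+5}+\cdots+\alpha_qt^{\ell+3q-1},\ t^{\ell+3q+2})$. 2. If $\ell=3n+1$ with $n$ even and $q=\frac n2$, then $\mathcal X_A=\mathcal S_q$. 3. If $\ell=3n+2$ with $n$ odd and $q=\frac{n-1}{2}$, then $\mathcal X_A=\mathcal S_q$. 4. If $\ell=3n+2$ with $n$ even and $q=\frac n2$, then $\mathcal X_A=\mathcal F_{1,q}\cup\mathcal S_q$; that is, the members of the first family are the ideals $(t^{\ell}+\alpha_1t^{\ell+1}+\alpha_2t^{\ell+4}+\cdots+\alpha_qt^{\ell+3q-2},\ t^{\ell+3q+1})$. Moreover, in each case every $I\in\mathcal X_A$ has exactly one presentation of the listed form: the family to which $I$ belongs, the integer $i$ (for a member of $\mathcal S_q$), and the coefficients $\alpha_j$ are uniquely determined by $I$. -/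

import Mathlib

open PowerSeries

/-! ### Numerical semigroup rings -/

/-- The semigroup ring `k[[H]]` of a submonoid `H` of `ℕ`, as a `k`-subalgebra of `V = k[[t]]`:
all power series in `t` whose exponents lie in `H`. (The variable `t` is `PowerSeries.X`.) -/
def semigroupRing (k : Type*) [Field k] (H : AddSubmonoid ℕ) : Subalgebra k k⟦X⟧ where
  carrier := {f | ∀ n, n ∉ H → coeff n f = 0}
  mul_mem' := by
    intro f g hf hg n hn
    rw [coeff_mul]
    refine Finset.sum_eq_zero fun p hp => ?_
    by_cases h1 : p.1 ∈ H
    · by_cases h2 : p.2 ∈ H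
      · exact absurd ((Finset.HasAntidiagonal.mem_antidiagonal.mp hp) ▸ H.add_mem h1 h2) hn
      · rw [hg _ h2, mul_zero]
    · rw [hf _ h1, zero_mul]
  add_mem' := by
    intro f g hf hg n hn
    rw [map_add, hf n hn, hg n hn, add_zero]
  algebraMap_mem' := by
    intro r n hn
    have h0 : n ≠ 0 := fun h => hn (h ▸ H.zero_mem)
    simp [coeff_C, h0]

theorem mem_semigroupRing {k : Type*} [Field k] {H : AddSubmonoid ℕ} {f : k⟦X⟧} :
    f ∈ semigroupRing k H ↔ ∀ n, n ∉ H → coeff n f = 0 := Iff.rfl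

theorem X_pow_mem_semigroupRing {k : Type*} [Field k] {H : AddSubmonoid ℕ} {m : ℕ} (hm : m ∈ H) :
    (X ^ m : k⟦X⟧) ∈ semigroupRing k H := by
  intro n hn
  rw [coeff_X_pow, if_neg]
  rintro rfl
  exact hn hm

theorem C_mul_X_pow_mem_semigroupRing {k : Type*} [Field k] {H : AddSubmonoid ℕ} {m : ℕ} (c : k)
    (hm : m ∈ H) : (C c * X ^ m : k⟦X⟧) ∈ semigroupRing k H :=
  (semigroupRing k H).mul_mem ((semigroupRing k H).algebraMap_mem c) (X_pow_mem_semigroupRing hm)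

theorem inv_mem_semigroupRing {k : Type*} [Field k] {H : AddSubmonoid ℕ} {f : k⟦X⟧}
    (hf : f ∈ semigroupRing k H) : f⁻¹ ∈ semigroupRing k H := by
  intro n
  induction n using Nat.strong_induction_on with
  | _ n ih =>
    intro hn
    have h0 : n ≠ 0 := fun h => hn (h ▸ H.zero_mem)
    rw [coeff_inv, if_neg h0]
    refine mul_eq_zero_of_right _ (Finset.sum_eq_zero fun p hp => ?_)
    split_ifs with hlt
    · by_cases h1 : p.1 ∈ H
      · by_cases h2 : p.2 ∈ H
        · exact absurd ((Finset.HasAntidiagonal.mem_antidiagonal.mp hp) ▸ H.add_mem h1 h2) hn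
        · rw [ih _ hlt h2, mul_zero]
      · rw [hf _ h1, zero_mul]
    · rfl

/-- A semigroup ring is a local ring: an element is a unit as soon as it is a unit of `k[[t]]`. -/
instance semigroupRing_isLocalRing (k : Type*) [Field k] (H : AddSubmonoid ℕ) :
    IsLocalRing (semigroupRing k H) := by
  have : IsLocalHom (semigroupRing k H).subtype := by
    constructor
    intro f hf
    have hc : constantCoeff (f : k⟦X⟧) ≠ 0 :=
      ((PowerSeries.isUnit_iff_constantCoeff).mp hf).ne_zero
    exact IsUnit.of_mul_eq_one ⟨(f : k⟦X⟧)⁻¹, inv_mem_semigroupRing f.2⟩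
      (Subtype.ext (PowerSeries.mul_inv_cancel _ hc))
  exact RingHom.domain_isLocalRing (semigroupRing k H).subtype

/-! ### Ulrich ideals -/

/-- `Q` is a parameter ideal of the local ring `A`: it is generated by `d = dim A` elements and is
primary to the maximal ideal. -/
def IsParameterIdeal {A : Type*} [CommRing A] [IsLocalRing A] (Q : Ideal A) : Prop :=
  ∃ (d : ℕ) (s : Fin d → A), ringKrullDim A = d ∧ Q = Ideal.span (Set.range s) ∧
    Q.radical = IsLocalRing.maximalIdeal A

/-- Ulrich ideals of a (Cohen-Macaulay) local ring `A`: ideals `I`, primary to the maximal ideal,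
that contain a parameter ideal `Q` with `I ≠ Q` and `I² = QI` (so that `Q` is a reduction of `I`),
and for which `I/I²` is a free `A/I`-module. -/
structure IsUlrichIdeal {A : Type*} [CommRing A] [IsLocalRing A] (I : Ideal A) : Prop where
  radical_eq : I.radical = IsLocalRing.maximalIdeal A
  exists_reduction : ∃ Q : Ideal A, IsParameterIdeal Q ∧ Q ≤ I ∧ I ≠ Q ∧ I ^ 2 = Q * I
  free_cotangent : Module.Free (A ⧸ I) I.Cotangent

/-- The set `𝒳_A` of Ulrich ideals of `A`. -/
def ulrichIdeals (A : Type*) [CommRing A] [IsLocalRing A] : Set (Ideal A) :=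
  {I | IsUlrichIdeal I}

/-! ### The ring `k[[t³, t^ℓ]]` and the normal forms -/

/-- The numerical semigroup `⟨3, ℓ⟩`. -/
abbrev semigroupThree (ℓ : ℕ) : AddSubmonoid ℕ := AddSubmonoid.closure {3, ℓ}

/-- The ring `k[[t³, t^ℓ]]`. -/
abbrev ringThree (k : Type*) [Field k] (ℓ : ℕ) : Subalgebra k k⟦X⟧ :=
  semigroupRing k (semigroupThree ℓ)

theorem semigroupThree_mul_mem (ℓ m : ℕ) : 3 * m ∈ semigroupThree ℓ := by
  have h : 3 ∈ semigroupThree ℓ := AddSubmonoid.subset_closure (by simp)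
  simpa [mul_comm] using (semigroupThree ℓ).nsmul_mem h m

theorem semigroupThree_self_mem (ℓ : ℕ) : ℓ ∈ semigroupThree ℓ := AddSubmonoid.subset_closure (by simp)

theorem semigroupThree_add_mul_mem (ℓ m : ℕ) : ℓ + 3 * m ∈ semigroupThree ℓ :=
  (semigroupThree ℓ).add_mem (semigroupThree_self_mem ℓ) (semigroupThree_mul_mem ℓ m)

theorem semigroupThree_add_add_mem {ℓ d : ℕ} (hd : 3 ∣ ℓ + d) (m : ℕ) : ℓ + d + 3 * m ∈ semigroupThree ℓ := by
  obtain ⟨r, hr⟩ := hd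
  rw [hr, ← mul_add]
  exact semigroupThree_mul_mem ℓ _

theorem semigroupThree_six_mul_mem (ℓ i : ℕ) : 6 * i ∈ semigroupThree ℓ := by
  have := semigroupThree_mul_mem ℓ (2 * i)
  rwa [← mul_assoc] at this

/-- The ideal `(t^ℓ + α₁ t^(ℓ+d) + α₂ t^(ℓ+d+3) + ⋯ + α_q t^(ℓ+d+3(q-1)), t^(ℓ+3q+d))` of
`k[[t³, t^ℓ]]`, for `d` with `3 ∣ ℓ + d`. The coefficient `α_(j+1)` is `α j`. -/
noncomputable def firstIdeal (k : Type*) [Field k] (ℓ d q : ℕ) (hd : 3 ∣ ℓ + d) (α : Fin q → k) :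
    Ideal (ringThree k ℓ) :=
  Ideal.span
    {⟨X ^ ℓ + ∑ j : Fin q, C (α j) * X ^ (ℓ + d + 3 * (j : ℕ)),
      (ringThree k ℓ).add_mem (X_pow_mem_semigroupRing (semigroupThree_self_mem ℓ))
        ((ringThree k ℓ).sum_mem fun j _ =>
          C_mul_X_pow_mem_semigroupRing (α j) (semigroupThree_add_add_mem hd j))⟩,
     ⟨X ^ (ℓ + 3 * q + d),
      X_pow_mem_semigroupRing (by
        have := semigroupThree_add_add_mem hd q
        rwa [add_right_comm] at this)⟩}

/-- The data of an ideal in the second normal form: an integer `1 ≤ i ≤ q` and coefficients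
`α₀, …, α_(i-1)` with `α₀ ≠ 0`. -/
structure SecondParam (k : Type*) [Field k] (q : ℕ) where
  i : ℕ
  one_le : 1 ≤ i
  le_q : i ≤ q
  α : Fin i → k
  ne_zero : α ⟨0, one_le⟩ ≠ 0

/-- The ideal `(t^(6i) + α₀ t^ℓ + α₁ t^(ℓ+3) + ⋯ + α_(i-1) t^(ℓ+3(i-1)), t^(ℓ+3i))` of
`k[[t³, t^ℓ]]`. -/
noncomputable def secondIdeal (k : Type*) [Field k] (ℓ : ℕ) {q : ℕ} (p : SecondParam k q) :
    Ideal (ringThree k ℓ) :=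
  Ideal.span
    {⟨X ^ (6 * p.i) + ∑ j : Fin p.i, C (p.α j) * X ^ (ℓ + 3 * (j : ℕ)),
      (ringThree k ℓ).add_mem (X_pow_mem_semigroupRing (semigroupThree_six_mul_mem ℓ p.i))
        ((ringThree k ℓ).sum_mem fun j _ =>
          C_mul_X_pow_mem_semigroupRing (p.α j) (semigroupThree_add_mul_mem ℓ j))⟩,
     ⟨X ^ (ℓ + 3 * p.i), X_pow_mem_semigroupRing (semigroupThree_add_mul_mem ℓ p.i)⟩}

/-!
Write `x = t³`, `y = t^ℓ` and `B = k[[x]]`. Then `A = k[[t³, t^ℓ]]` is free over `B` with basis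
`1, y, y²`, and `y³ = x^ℓ` (`IsCuspExtension`, `isCuspExtension_ringThree`); only this description
of `A` is used to determine its Ulrich ideals. The result (`IsCuspExtension.isUlrichIdeal_iff`) is
that they are the ideals `I = (y - g, x^m)` with `m ≥ 1`, `g ∈ B` and `ord (g³ - x^ℓ) = 2 m`.

Let `I` be Ulrich. It is not principal, and `y` acts on `I / x I`, a space of dimension at most
three, with cokernel `I / 𝔪 I` of dimension at least two. A count of dimensions gives a minimal
generator `v` of `I` with `y v ∈ x I` (`exists_minimal_generator`). As `I / I²` is free, `v` has a
unit coordinate in a basis, and the relation `y v ∈ x I` forces `y ∈ x A + I`; by Nakayama's lemma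
`A / I` is a quotient of the discrete valuation ring `B`, that is, `I = (y - g, x^m)`. Put
`w = y - g`. The cubic equation of `w`,
`(w² + 3 g w + 3 g²) w + (g³ - x^ℓ) = 0`,
is a relation between the generators `w, x^m`, whose classes form a basis of `I / I²`. Hence its
coefficient at `x^m` lies in `I ∩ B = (x^m)`, so that `x^(2m) ∣ g³ - x^ℓ`. If the quotient were not
a unit, then `x^(2m), x^m w, w²` would be minimal generators of `I²`, which contradicts `I² = a I`
(`sq_ne_span_singleton_mul`). Conversely, if `g³ - x^ℓ = x^(2m) ε` with a unit `ε`, then the cubic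
equation shows `x^(2m) ∈ w I`, so that `I² = w I`, and that every relation between `w` and `x^m`
has coefficients in `I` (`isUlrichIdeal_span_pair`).

As `3 ∤ ℓ`, the condition on `g` means that either `2 m = ℓ ≤ 3 ord g`, or `m = 3 i` and
`ord g = 2 i` with `6 i < ℓ` (`PowerSeries.exists_isUnit_cube_sub_iff`). The first case is the first
normal form. In the second case `g = -x^(2i) / f` with a unit `f`, and multiplication by `f` turns
`(y - g, x^(3i))` into `(x^(2i) + f y, x^i y)`, the second normal form. The ideal determines `m`, and
`g` modulo `x^m`, because `I ∩ B = (x^m)`; this gives uniqueness.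
-/

/-! ### Power series in one variable -/

section PowerSeriesLemmas

variable {k : Type*} [Field k]

theorem PowerSeries.exists_eq_X_pow_mul_isUnit {f : k⟦X⟧} (hf : f ≠ 0) :
    ∃ (n : ℕ) (u : k⟦X⟧), IsUnit u ∧ f = X ^ n * u := by
  obtain ⟨n, u, h⟩ :=
    IsDiscreteValuationRing.eq_unit_mul_pow_irreducible hf (X_irreducible (R := k))
  exact ⟨n, u, u.isUnit, by rw [h, mul_comm]⟩

theorem PowerSeries.isUnit_iff_not_X_dvd {f : k⟦X⟧} : IsUnit f ↔ ¬ X ∣ f := by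
  rw [X_dvd_iff, isUnit_iff_constantCoeff, isUnit_iff_ne_zero]

theorem PowerSeries.X_pow_dvd_X_pow_mul_isUnit {n a : ℕ} {u : k⟦X⟧} (hu : IsUnit u) :
    X ^ n ∣ X ^ a * u ↔ n ≤ a := by
  rw [hu.dvd_mul_right, pow_dvd_pow_iff X_ne_zero X_irreducible.not_isUnit]

theorem PowerSeries.X_pow_dvd_X_pow {n a : ℕ} : (X : k⟦X⟧) ^ n ∣ X ^ a ↔ n ≤ a :=
  pow_dvd_pow_iff X_ne_zero X_irreducible.not_isUnit

/-- As `3 ∤ ℓ`, the orders of `g ^ 3` and `X ^ ℓ` differ, so no cancellation occurs in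
`g ^ 3 - X ^ ℓ`. -/
theorem PowerSeries.X_pow_dvd_cube_sub {ℓ N : ℕ} (hℓ : ¬ 3 ∣ ℓ) {g : k⟦X⟧} :
    X ^ N ∣ g ^ 3 - X ^ ℓ ↔ X ^ N ∣ g ^ 3 ∧ N ≤ ℓ := by
  refine ⟨fun h => ?_, fun h => dvd_sub h.1 (pow_dvd_pow _ h.2)⟩
  by_cases hN : N ≤ ℓ
  · exact ⟨by simpa using dvd_add h (pow_dvd_pow X hN), hN⟩
  exfalso
  have hl : X ^ (ℓ + 1) ∣ g ^ 3 - X ^ ℓ := (pow_dvd_pow X (by omega)).trans h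
  have hg0 : g ≠ 0 := by
    rintro rfl
    rw [zero_pow three_ne_zero, zero_sub, dvd_neg, X_pow_dvd_X_pow] at hl
    omega
  obtain ⟨v, u, hu, rfl⟩ := exists_eq_X_pow_mul_isUnit hg0
  rw [mul_pow, ← pow_mul] at hl
  rcases lt_or_ge (v * 3) ℓ with h3 | h3
  · have h1 : X ^ (v * 3 + 1) ∣ X ^ (v * 3) * u ^ 3 := by
      simpa using dvd_add ((pow_dvd_pow X (by omega : v * 3 + 1 ≤ ℓ + 1)).trans hl)
        (pow_dvd_pow X (by omega : v * 3 + 1 ≤ ℓ))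
    rw [X_pow_dvd_X_pow_mul_isUnit (hu.pow 3)] at h1
    omega
  · have h1 : (X : k⟦X⟧) ^ (ℓ + 1) ∣ X ^ ℓ := by
      have := dvd_sub (Dvd.dvd.mul_right (pow_dvd_pow X (by omega : ℓ + 1 ≤ v * 3)) (u ^ 3)) hl
      simpa using this
    rw [X_pow_dvd_X_pow] at h1
    omega

theorem PowerSeries.X_pow_dvd_pow_of_cube {N M : ℕ} (e : ℕ) {g : k⟦X⟧} (h : X ^ N ∣ g ^ 3)
    (hM : ∀ v, N ≤ 3 * v → M ≤ e * v) (he : e ≠ 0) : X ^ M ∣ g ^ e := by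
  rcases eq_or_ne g 0 with rfl | hg0
  · simp [zero_pow he]
  obtain ⟨v, u, hu, rfl⟩ := exists_eq_X_pow_mul_isUnit hg0
  rw [mul_pow, ← pow_mul, X_pow_dvd_X_pow_mul_isUnit (hu.pow _)] at h ⊢
  have := hM v (by omega)
  rwa [mul_comm]

end PowerSeriesLemmas

/-! ### Cubic extensions of the ring of power series -/

/-- The local ring `A` is the extension `k⟦X⟧[y] / (y³ - X^ℓ)` of `k⟦X⟧`, presented by
coordinates: `1, y, y²` is a basis of `A` over `k⟦X⟧` and `y³ = X^ℓ`. -/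
structure IsCuspExtension {k A : Type*} [Field k] [CommRing A] [IsLocalRing A] [Algebra k⟦X⟧ A]
    (ℓ : ℕ) (y : A) : Prop where
  pow_three : y ^ 3 = algebraMap k⟦X⟧ A (X ^ ℓ)
  exists_coord : ∀ a : A, ∃ f₀ f₁ f₂ : k⟦X⟧,
    a = algebraMap _ A f₀ + algebraMap _ A f₁ * y + algebraMap _ A f₂ * y ^ 2
  coord_eq_zero : ∀ f₀ f₁ f₂ : k⟦X⟧,
    algebraMap _ A f₀ + algebraMap _ A f₁ * y + algebraMap _ A f₂ * y ^ 2 = 0 →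
      f₀ = 0 ∧ f₁ = 0 ∧ f₂ = 0
  X_mem : algebraMap k⟦X⟧ A X ∈ IsLocalRing.maximalIdeal A

namespace IsCuspExtension

open IsLocalRing

variable {k A : Type*} [Field k] [CommRing A] [IsLocalRing A] [Algebra k⟦X⟧ A]
  {ℓ : ℕ} {y : A}

local notation "ι" => algebraMap k⟦X⟧ A

theorem algebraMap_injective (h : IsCuspExtension (k := k) ℓ y) : Function.Injective ι := by
  refine (injective_iff_map_eq_zero _).mpr fun f hf => ?_
  exact (h.coord_eq_zero f 0 0 (by simp [hf])).1

theorem y_mem (h : IsCuspExtension (k := k) ℓ y) (hℓ : ℓ ≠ 0) : y ∈ maximalIdeal A := by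
  refine Ideal.IsPrime.mem_of_pow_mem inferInstance 3 ?_
  rw [h.pow_three, map_pow]
  exact Ideal.pow_mem_of_mem _ h.X_mem _ (Nat.pos_of_ne_zero hℓ)

theorem algebraMap_mem_of_X_dvd (h : IsCuspExtension (k := k) ℓ y) {f : k⟦X⟧} (hf : X ∣ f) :
    ι f ∈ maximalIdeal A :=
  Ideal.mem_of_dvd _ (map_dvd ι hf) h.X_mem

theorem algebraMap_mem_iff (h : IsCuspExtension (k := k) ℓ y) {f : k⟦X⟧} :
    ι f ∈ maximalIdeal A ↔ X ∣ f := by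
  refine ⟨fun hf => ?_, h.algebraMap_mem_of_X_dvd⟩
  by_contra hX
  exact (mem_maximalIdeal _).mp hf ((isUnit_iff_not_X_dvd.mpr hX).map ι)

/-- The maximal ideal is generated by `X` and `y`. -/
theorem exists_eq_of_mem_maximalIdeal (h : IsCuspExtension (k := k) ℓ y) (hℓ : ℓ ≠ 0) {a : A}
    (ha : a ∈ maximalIdeal A) : ∃ b c : A, a = b * ι X + c * y := by
  obtain ⟨f₀, f₁, f₂, rfl⟩ := h.exists_coord a
  have hf : ι f₀ ∈ maximalIdeal A := by
    have := (maximalIdeal A).sub_mem ha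
      ((maximalIdeal A).mul_mem_left (ι f₁ + ι f₂ * y) (h.y_mem hℓ))
    convert this using 1
    ring
  obtain ⟨q, rfl⟩ := h.algebraMap_mem_iff.mp hf
  exact ⟨ι q, ι f₁ + ι f₂ * y, by rw [map_mul]; ring⟩

/-- Any element that is congruent to `y` modulo `k⟦X⟧` yields a basis `1, y - g, (y - g)²`. -/
theorem exists_coord_sub (h : IsCuspExtension (k := k) ℓ y) (g : k⟦X⟧) (a : A) :
    ∃ f₀ f₁ f₂ : k⟦X⟧, a = ι f₀ + ι f₁ * (y - ι g) + ι f₂ * (y - ι g) ^ 2 := by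
  obtain ⟨f₀, f₁, f₂, rfl⟩ := h.exists_coord a
  refine ⟨f₀ + f₁ * g + f₂ * g ^ 2, f₁ + 2 * f₂ * g, f₂, ?_⟩
  simp only [map_add, map_mul, map_pow, map_ofNat]
  ring

theorem coord_sub_eq_zero (h : IsCuspExtension (k := k) ℓ y) (g : k⟦X⟧) {f₀ f₁ f₂ : k⟦X⟧}
    (hf : ι f₀ + ι f₁ * (y - ι g) + ι f₂ * (y - ι g) ^ 2 = 0) : f₀ = 0 ∧ f₁ = 0 ∧ f₂ = 0 := by
  obtain ⟨h0, h1, rfl⟩ := h.coord_eq_zero (f₀ - f₁ * g + f₂ * g ^ 2) (f₁ - 2 * f₂ * g) f₂ (by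
    rw [← hf]
    simp only [map_add, map_sub, map_mul, map_pow, map_ofNat]
    ring)
  simp only [mul_zero, zero_mul, sub_zero, add_zero] at h0 h1
  subst h1
  simpa using h0

/-- The cubic equation of `w = y - g` over `k⟦X⟧`. -/
theorem sub_cube (h : IsCuspExtension (k := k) ℓ y) (g : k⟦X⟧) :
    (y - ι g) ^ 3 = -(ι (3 * g) * (y - ι g) ^ 2 + ι (3 * g ^ 2) * (y - ι g) +
      ι (g ^ 3 - X ^ ℓ)) := by
  have := h.pow_three
  simp only [map_sub, map_mul, map_pow, map_ofNat] at this ⊢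
  linear_combination this

/-- The ideal `(y - g, X ^ m)` is the kernel of the evaluation `y ↦ g` with values in
`k⟦X⟧ / (X ^ m)`, which is well defined as soon as `X ^ m ∣ g³ - X ^ ℓ`. -/
theorem mem_span_pair_iff (h : IsCuspExtension (k := k) ℓ y) {m : ℕ} {g : k⟦X⟧}
    (hg : X ^ m ∣ g ^ 3 - X ^ ℓ) {f₀ f₁ f₂ : k⟦X⟧} :
    ι f₀ + ι f₁ * y + ι f₂ * y ^ 2 ∈ Ideal.span {y - ι g, ι (X ^ m)} ↔
      X ^ m ∣ f₀ + f₁ * g + f₂ * g ^ 2 := by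
  rw [Ideal.mem_span_pair]
  constructor
  · rintro ⟨p, r, hpr⟩
    obtain ⟨p₀, p₁, p₂, rfl⟩ := h.exists_coord p
    obtain ⟨r₀, r₁, r₂, rfl⟩ := h.exists_coord r
    obtain ⟨h0, h1, h2⟩ := h.coord_eq_zero
      (p₂ * X ^ ℓ - p₀ * g + r₀ * X ^ m - f₀) (p₀ - p₁ * g + r₁ * X ^ m - f₁)
      (p₁ - p₂ * g + r₂ * X ^ m - f₂) (by
        have := h.pow_three
        simp only [map_add, map_sub, map_mul, map_pow] at hpr this ⊢
        linear_combination hpr - ι p₂ * this)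
    have key : f₀ + f₁ * g + f₂ * g ^ 2 =
        X ^ m * (r₀ + r₁ * g + r₂ * g ^ 2) - p₂ * (g ^ 3 - X ^ ℓ) := by
      linear_combination -h0 - g * h1 - g ^ 2 * h2
    rw [key]
    exact dvd_sub (dvd_mul_right _ _) (hg.mul_left _)
  · rintro ⟨q, hq⟩
    refine ⟨ι f₁ + ι f₂ * (y + ι g), ι q, ?_⟩
    have := congrArg ι hq
    simp only [map_add, map_mul, map_pow] at this ⊢
    linear_combination -this

theorem algebraMap_mem_span_pair_iff (h : IsCuspExtension (k := k) ℓ y) {m : ℕ} {g : k⟦X⟧}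
    (hg : X ^ m ∣ g ^ 3 - X ^ ℓ) {f : k⟦X⟧} :
    ι f ∈ Ideal.span {y - ι g, ι (X ^ m)} ↔ X ^ m ∣ f := by
  simpa using h.mem_span_pair_iff hg (f₀ := f) (f₁ := 0) (f₂ := 0)

/-- The ideal `(y - g, X ^ m)` determines `m`, and `g` modulo `X ^ m`. -/
theorem span_pair_inj (h : IsCuspExtension (k := k) ℓ y) {m m' : ℕ} {g g' : k⟦X⟧}
    (hg : X ^ m ∣ g ^ 3 - X ^ ℓ) (hg' : X ^ m' ∣ g' ^ 3 - X ^ ℓ)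
    (heq : (Ideal.span {y - ι g, ι (X ^ m)} : Ideal A) = Ideal.span {y - ι g', ι (X ^ m')}) :
    m = m' ∧ X ^ m ∣ g - g' := by
  have h1 : ∀ f : k⟦X⟧, X ^ m ∣ f ↔ X ^ m' ∣ f := fun f => by
    rw [← h.algebraMap_mem_span_pair_iff hg, heq, h.algebraMap_mem_span_pair_iff hg']
  refine ⟨le_antisymm (X_pow_dvd_X_pow.mp ((h1 _).mpr dvd_rfl))
    (X_pow_dvd_X_pow.mp ((h1 _).mp dvd_rfl)), ?_⟩
  rw [← h.algebraMap_mem_span_pair_iff hg]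
  have h2 : y - ι g ∈ Ideal.span {y - ι g, ι (X ^ m)} := Ideal.subset_span (by simp)
  have h3 : y - ι g' ∈ Ideal.span {y - ι g, ι (X ^ m)} := heq ▸ Ideal.subset_span (by simp)
  convert Ideal.sub_mem _ h3 h2 using 1
  rw [map_sub]
  ring

theorem isIntegral (h : IsCuspExtension (k := k) ℓ y) : Algebra.IsIntegral k⟦X⟧ A := by
  have hy : IsIntegral k⟦X⟧ y := by
    refine IsIntegral.of_pow (n := 3) (by norm_num) ?_
    rw [h.pow_three]
    exact isIntegral_algebraMap
  refine ⟨fun a => ?_⟩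
  obtain ⟨f₀, f₁, f₂, rfl⟩ := h.exists_coord a
  exact (isIntegral_algebraMap.add (isIntegral_algebraMap.mul hy)).add
    (isIntegral_algebraMap.mul (hy.pow 2))

/-- An ideal that contains a power of `X` also contains a power of `y`, as `y³ = X ^ ℓ`. -/
theorem maximalIdeal_le_radical (h : IsCuspExtension (k := k) ℓ y) (hℓ : ℓ ≠ 0) {I : Ideal A}
    {N : ℕ} (hN : ι (X ^ N) ∈ I) : maximalIdeal A ≤ I.radical := by
  have hX : ι X ∈ I.radical := ⟨N, by rwa [← map_pow]⟩
  have hy : y ∈ I.radical := by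
    refine Ideal.mem_radical_of_pow_mem (m := 3) ?_
    rw [h.pow_three, map_pow]
    exact Ideal.pow_mem_of_mem _ hX _ (Nat.pos_of_ne_zero hℓ)
  intro a ha
  obtain ⟨b, c, rfl⟩ := h.exists_eq_of_mem_maximalIdeal hℓ ha
  exact add_mem (Ideal.mul_mem_left _ _ hX) (Ideal.mul_mem_left _ _ hy)

theorem exists_X_pow_mem [IsDomain A] (h : IsCuspExtension (k := k) ℓ y) {I : Ideal A} {a : A}
    (ha : a ∈ I) (ha0 : a ≠ 0) : ∃ N, ι (X ^ N) ∈ I := by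
  have := h.isIntegral
  obtain ⟨f, hf, hf0⟩ := Submodule.exists_mem_ne_zero_of_ne_bot
    (Ideal.comap_ne_bot_of_integral_mem (R := k⟦X⟧) ha0 ha (Algebra.IsIntegral.isIntegral a))
  obtain ⟨N, u, hu, rfl⟩ := exists_eq_X_pow_mul_isUnit hf0
  refine ⟨N, ?_⟩
  rw [Ideal.mem_comap, map_mul] at hf
  exact (Ideal.mul_unit_mem_iff_mem _ (hu.map ι)).mp hf

theorem ringKrullDim_eq_one [IsDomain A] (h : IsCuspExtension (k := k) ℓ y) (hℓ : ℓ ≠ 0) :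
    ringKrullDim A = 1 := by
  refine ringKrullDim_eq_one_iff_of_isLocalRing_isDomain.mpr ⟨fun hF => ?_, fun a ha => ?_⟩
  · have h1 := h.X_mem
    rw [isField_iff_maximalIdeal_eq.mp hF, Ideal.mem_bot, map_eq_zero_iff _ h.algebraMap_injective]
      at h1
    exact X_ne_zero h1
  · obtain ⟨N, hN⟩ := h.exists_X_pow_mem (Ideal.mem_span_singleton_self a) ha
    exact h.maximalIdeal_le_radical hℓ hN

end IsCuspExtension

/-! ### Conormal modules of two-generated ideals -/

section Cotangent

variable {A : Type*} [CommRing A]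

theorem Ideal.span_range_toCotangent_pair {u v : A} {I : Ideal A} (hu : u ∈ I) (hv : v ∈ I)
    (hI : I ≤ Ideal.span {u, v}) :
    ⊤ ≤ Submodule.span (A ⧸ I) (Set.range ![I.toCotangent ⟨u, hu⟩, I.toCotangent ⟨v, hv⟩]) := by
  rintro z -
  obtain ⟨⟨a, ha⟩, rfl⟩ := I.toCotangent_surjective z
  obtain ⟨p, q, hpq⟩ := Ideal.mem_span_pair.mp (hI ha)
  have : I.toCotangent ⟨a, ha⟩ = Ideal.Quotient.mk I p • I.toCotangent ⟨u, hu⟩ +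
      Ideal.Quotient.mk I q • I.toCotangent ⟨v, hv⟩ := by
    have hz : (⟨a, ha⟩ : I) = p • ⟨u, hu⟩ + q • ⟨v, hv⟩ := Subtype.ext (by simp [← hpq])
    rw [hz, map_add, map_smul, map_smul]
    rfl
  rw [this]
  exact add_mem (Submodule.smul_mem _ _ (Submodule.subset_span ⟨0, rfl⟩))
    (Submodule.smul_mem _ _ (Submodule.subset_span ⟨1, rfl⟩))

theorem Ideal.linearIndependent_toCotangent_pair_iff {u v : A} {I : Ideal A} (hu : u ∈ I)
    (hv : v ∈ I) :
    LinearIndependent (A ⧸ I) ![I.toCotangent ⟨u, hu⟩, I.toCotangent ⟨v, hv⟩] ↔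
      ∀ p q : A, p * u + q * v ∈ I ^ 2 → p ∈ I ∧ q ∈ I := by
  have key : ∀ p q : A, Ideal.Quotient.mk I p • I.toCotangent ⟨u, hu⟩ +
      Ideal.Quotient.mk I q • I.toCotangent ⟨v, hv⟩ = 0 ↔ p * u + q * v ∈ I ^ 2 := by
    intro p q
    have : Ideal.Quotient.mk I p • I.toCotangent ⟨u, hu⟩ +
        Ideal.Quotient.mk I q • I.toCotangent ⟨v, hv⟩ =
        I.toCotangent (p • ⟨u, hu⟩ + q • ⟨v, hv⟩) := by
      rw [map_add, map_smul, map_smul]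
      rfl
    rw [this, I.toCotangent_eq_zero]
    simp
  rw [LinearIndependent.pair_iff]
  constructor
  · intro h p q hpq
    obtain ⟨h1, h2⟩ := h _ _ ((key p q).mpr hpq)
    exact ⟨Ideal.Quotient.eq_zero_iff_mem.mp h1, Ideal.Quotient.eq_zero_iff_mem.mp h2⟩
  · intro h s t hst
    obtain ⟨p, rfl⟩ := Ideal.Quotient.mk_surjective s
    obtain ⟨q, rfl⟩ := Ideal.Quotient.mk_surjective t
    obtain ⟨h1, h2⟩ := h p q ((key p q).mp hst)
    exact ⟨Ideal.Quotient.eq_zero_iff_mem.mpr h1, Ideal.Quotient.eq_zero_iff_mem.mpr h2⟩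

/-- If `I / I²` is generated by one element, then `I` is principal, by Nakayama's lemma. -/
theorem Ideal.exists_eq_span_singleton_of_le_sup [IsLocalRing A] {I : Ideal A} (hfg : I.FG) {v : A}
    (hv : v ∈ I) (hle : I ≤ Ideal.span {v} ⊔ IsLocalRing.maximalIdeal A • I) :
    I = Ideal.span {v} :=
  le_antisymm (Submodule.le_of_le_smul_of_le_jacobson_bot hfg
    (IsLocalRing.maximalIdeal_le_jacobson _) hle) ((Ideal.span_singleton_le_iff_mem _).mpr hv)

/-- A non-principal two-generated ideal with free conormal module has conormal module of rank
two, so that the classes of the two generators form a basis. -/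
theorem Ideal.linearIndependent_toCotangent_pair [IsLocalRing A] {u v : A} {I : Ideal A}
    (hI : I = Ideal.span {u, v}) (hu : u ∈ I) (hv : v ∈ I) (hne : I ≠ ⊤)
    (hnp : ∀ a, I ≠ Ideal.span {a}) [Module.Free (A ⧸ I) I.Cotangent] :
    LinearIndependent (A ⧸ I) ![I.toCotangent ⟨u, hu⟩, I.toCotangent ⟨v, hv⟩] := by
  have hspan := Ideal.span_range_toCotangent_pair hu hv hI.le
  have : Nontrivial (A ⧸ I) := Ideal.Quotient.nontrivial_iff.mpr hne
  have hfin : Module.Finite (A ⧸ I) I.Cotangent :=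
    ⟨by rw [← top_le_iff.mp hspan]; exact Submodule.fg_span (Set.finite_range _)⟩
  refine linearIndependent_of_top_le_span_of_card_le_finrank hspan ?_
  rw [Fintype.card_fin]
  by_contra hlt
  have h1 : Module.finrank (A ⧸ I) I.Cotangent ≤ 1 := by omega
  obtain ⟨z, hz⟩ : ∃ z : I.Cotangent, ∀ t, ∃ c : A ⧸ I, t = c • z := by
    rcases Nat.le_one_iff_eq_zero_or_eq_one.mp h1 with h0 | h0
    · let b' := Module.finBasisOfFinrankEq (A ⧸ I) I.Cotangent h0
      have : Subsingleton I.Cotangent := b'.repr.toEquiv.subsingleton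
      exact ⟨0, fun t => ⟨0, Subsingleton.elim _ _⟩⟩
    · let b' := Module.finBasisOfFinrankEq (A ⧸ I) I.Cotangent h0
      exact ⟨b' 0, fun t => ⟨b'.repr t 0, by
        conv_lhs => rw [← b'.sum_repr t]
        simp⟩⟩
  obtain ⟨⟨a, ha⟩, rfl⟩ := I.toCotangent_surjective z
  refine hnp a (Ideal.exists_eq_span_singleton_of_le_sup
    (hI ▸ Submodule.fg_span (Set.toFinite _)) ha fun b hb => ?_)
  obtain ⟨c, hc⟩ := hz (I.toCotangent ⟨b, hb⟩)
  obtain ⟨c, rfl⟩ := Ideal.Quotient.mk_surjective c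
  have hc' : I.toCotangent ⟨b, hb⟩ = I.toCotangent (c • ⟨a, ha⟩) := by rw [hc, map_smul]; rfl
  rw [I.toCotangent_eq] at hc'
  have h2 : I ^ 2 ≤ IsLocalRing.maximalIdeal A • I := by
    rw [pow_two, smul_eq_mul]
    exact Ideal.mul_mono_left (IsLocalRing.le_maximalIdeal hne)
  have : b = c * a + (b - c * a) := by ring
  rw [this]
  exact Submodule.add_mem_sup (Ideal.mul_mem_left _ _ (Ideal.mem_span_singleton_self a))
    (h2 (by simpa using hc'))

end Cotangent

namespace IsCuspExtension

/-! ### The ideals `(y - g, X ^ m)` that are Ulrich -/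

open IsLocalRing

variable {k A : Type*} [Field k] [CommRing A] [IsLocalRing A] [IsDomain A] [Algebra k⟦X⟧ A]
  {ℓ : ℕ} {y : A}

local notation "ι" => algebraMap k⟦X⟧ A

theorem X_dvd_of_cube_sub {m : ℕ} {g : k⟦X⟧} (hm : m ≠ 0) (hℓ : ¬ 3 ∣ ℓ)
    (hg : X ^ (2 * m) ∣ g ^ 3 - X ^ ℓ) : X ∣ g :=
  X_prime.dvd_of_dvd_pow ((dvd_pow_self X (by omega)).trans ((X_pow_dvd_cube_sub hℓ).mp hg).1)

/-- A sufficient condition for `I = (y - g, X ^ m)` to be an Ulrich ideal; the reduction is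
`(y - g)`. The equation of `w = y - g` reads `w (w² + 3 g w + 3 g²) = -ε X ^ (2 * m)`. -/
theorem isUlrichIdeal_span_pair (h : IsCuspExtension (k := k) ℓ y) (hℓ : ¬ 3 ∣ ℓ) {m : ℕ}
    (hm : m ≠ 0) {g ε : k⟦X⟧} (hε : IsUnit ε) (hg : g ^ 3 - X ^ ℓ = X ^ (2 * m) * ε) :
    IsUlrichIdeal (Ideal.span {y - ι g, ι (X ^ m)} : Ideal A) := by
  have hℓ0 : ℓ ≠ 0 := by rintro rfl; simp at hℓ
  have hdvd : X ^ (2 * m) ∣ g ^ 3 - X ^ ℓ := ⟨ε, hg⟩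
  have hdvd' : X ^ m ∣ g ^ 3 - X ^ ℓ := (pow_dvd_pow _ (by omega)).trans hdvd
  obtain ⟨d, hd⟩ : X ^ m ∣ g ^ 2 :=
    X_pow_dvd_pow_of_cube 2 ((X_pow_dvd_cube_sub hℓ).mp hdvd).1 (fun v hv => by omega) two_ne_zero
  have hXg : X ∣ g := X_dvd_of_cube_sub hm hℓ hdvd
  set I : Ideal A := Ideal.span {y - ι g, ι (X ^ m)} with hI
  obtain ⟨w, hw⟩ : ∃ w, w = y - ι g := ⟨_, rfl⟩
  rw [← hw] at hI
  have hcube := h.sub_cube g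
  rw [← hw, hg, hd] at hcube
  simp only [map_mul, map_pow, map_ofNat] at hcube
  have hwI : w ∈ I := hI ▸ Ideal.subset_span (by simp)
  have hXI : ι X ^ m ∈ I := hI ▸ Ideal.subset_span (by simp)
  have hwm : w ∈ maximalIdeal A := hw ▸ sub_mem (h.y_mem hℓ0) (h.algebraMap_mem_of_X_dvd hXg)
  have hIm : I ≤ maximalIdeal A := by
    rw [hI, Ideal.span_le]
    rintro z (rfl | rfl)
    · exact hwm
    · exact h.algebraMap_mem_of_X_dvd (dvd_pow_self X hm)
  obtain ⟨η, hη⟩ := hε.exists_right_inv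
  have hη' : ι ε * ι η = 1 := by rw [← map_mul, hη, map_one]
  -- `X ^ (2 * m)` is a multiple of `w`, with cofactor in `I`
  set c : A := -ι η * (w ^ 2 + 3 * ι g * w + 3 * (ι X ^ m * ι d)) with hc
  have hcI : c ∈ I := by
    refine I.mul_mem_left _ (add_mem (add_mem ?_ ?_) ?_)
    · exact Ideal.pow_mem_of_mem _ hwI _ two_pos
    · exact I.mul_mem_left _ hwI
    · exact I.mul_mem_left _ (I.mul_mem_right _ hXI)
  have hX2 : ι X ^ (2 * m) = w * c := by
    rw [hc]
    linear_combination ι η * hcube - ι X ^ (2 * m) * hη'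
  have hw0 : w ≠ 0 := by
    intro h0
    rw [h0, zero_mul, ← map_pow, map_eq_zero_iff _ h.algebraMap_injective] at hX2
    exact pow_ne_zero _ X_ne_zero hX2
  have hwspan : (Ideal.span {w} : Ideal A) = Ideal.span {w, ι (X ^ (2 * m))} := by
    refine le_antisymm (Ideal.span_mono (by simp)) (Ideal.span_le.mpr ?_)
    rintro z (rfl | rfl)
    · exact Ideal.mem_span_singleton_self _
    · rw [map_pow, hX2]
      exact Ideal.mul_mem_right _ _ (Ideal.mem_span_singleton_self _)
  have hsq : I ^ 2 = Ideal.span {w} * I := by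
    refine le_antisymm ?_ (by
      rw [pow_two]; exact Ideal.mul_mono_left ((Ideal.span_singleton_le_iff_mem _).mpr hwI))
    rw [pow_two, Ideal.mul_le]
    intro a ha b hb
    rw [hI, Ideal.mem_span_pair] at ha hb
    obtain ⟨p, q, rfl⟩ := ha
    obtain ⟨r, s, rfl⟩ := hb
    rw [Ideal.mem_span_singleton_mul]
    refine ⟨p * (r * w + s * ι X ^ m) + q * r * ι X ^ m + q * s * c, ?_, ?_⟩
    · exact add_mem (add_mem (I.mul_mem_left _ (add_mem (I.mul_mem_left _ hwI)
        (I.mul_mem_left _ hXI))) (I.mul_mem_left _ hXI)) (I.mul_mem_left _ hcI)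
    · simp only [map_pow]
      linear_combination -q * s * hX2
  have hXw : ∀ f₀ f₁ f₂ : k⟦X⟧, ι f₀ + ι f₁ * y + ι f₂ * y ^ 2 ∈ Ideal.span {w} ↔
      X ^ (2 * m) ∣ f₀ + f₁ * g + f₂ * g ^ 2 := fun f₀ f₁ f₂ => by
    rw [hwspan, hw]
    exact h.mem_span_pair_iff hdvd
  refine ⟨?_, ⟨Ideal.span {w}, ⟨1, fun _ => w, ?_, ?_, ?_⟩, ?_, ?_, hsq⟩, ?_⟩
  · exact le_antisymm ((Ideal.IsPrime.radical_le_iff inferInstance).mpr hIm)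
      (h.maximalIdeal_le_radical hℓ0 (by rw [map_pow]; exact hXI))
  · exact_mod_cast h.ringKrullDim_eq_one hℓ0
  · rw [Set.range_const]
  · refine le_antisymm ((Ideal.IsPrime.radical_le_iff inferInstance).mpr
      ((Ideal.span_singleton_le_iff_mem _).mpr hwm))
      (h.maximalIdeal_le_radical hℓ0 (N := 2 * m) ?_)
    rw [hwspan]
    exact Ideal.subset_span (by simp)
  · exact (Ideal.span_singleton_le_iff_mem _).mpr hwI
  · intro heq
    have h1 := (hXw (X ^ m) 0 0).mp (by rw [← heq]; simpa using hXI)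
    simp only [zero_mul, add_zero] at h1
    rw [X_pow_dvd_X_pow] at h1
    omega
  · have hli : LinearIndependent (A ⧸ I) ![I.toCotangent ⟨w, hwI⟩, I.toCotangent ⟨_, hXI⟩] := by
      rw [Ideal.linearIndependent_toCotangent_pair_iff]
      intro p q hpq
      rw [hsq, Ideal.mem_span_singleton_mul] at hpq
      obtain ⟨z, hz, hzw⟩ := hpq
      -- the relation `(p - z) w + q X ^ m = 0` shows that `q X ^ m ∈ (w)`, hence `q ∈ I`
      have hq : q ∈ I := by
        obtain ⟨q₀, q₁, q₂, rfl⟩ := h.exists_coord q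
        rw [hI, hw, h.mem_span_pair_iff hdvd']
        have h1 := (hXw (X ^ m * q₀) (X ^ m * q₁) (X ^ m * q₂)).mp (by
          rw [Ideal.mem_span_singleton']
          refine ⟨z - p, ?_⟩
          simp only [map_mul, map_pow]
          linear_combination hzw)
        rw [two_mul, pow_add] at h1
        refine (mul_dvd_mul_iff_left (pow_ne_zero m (X_ne_zero (R := k)))).mp (h1.trans ?_)
        exact dvd_of_eq (by ring)
      refine ⟨?_, hq⟩
      obtain ⟨q₁, q₂, hq12⟩ := Ideal.mem_span_pair.mp hq
      rw [map_pow, ← hw] at hq12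
      have hp : p = z - (q₁ * ι X ^ m + q₂ * c) := by
        apply mul_right_cancel₀ hw0
        rw [← hq12] at hzw
        linear_combination -hzw - q₂ * hX2
      rw [hp]
      exact sub_mem hz (add_mem (I.mul_mem_left _ hXI) (I.mul_mem_left _ hcI))
    exact Module.Free.of_basis (Module.Basis.mk hli
      (Ideal.span_range_toCotangent_pair hwI hXI (by rw [hI, map_pow])))

end IsCuspExtension

/-! ### Reductions and relations -/

section Reduction

open IsLocalRing

variable {A : Type*} [CommRing A] [IsLocalRing A]

/-- In dimension one, the reduction of an Ulrich ideal is principal. -/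
theorem IsUlrichIdeal.exists_sq_eq_span_singleton_mul (hdim : ringKrullDim A = 1) {I : Ideal A}
    (hI : IsUlrichIdeal I) :
    ∃ a ∈ I, I ≠ Ideal.span {a} ∧ I ^ 2 = Ideal.span {a} * I := by
  obtain ⟨Q, ⟨d, s, hd, rfl, -⟩, hQI, hne, hsq⟩ := hI.exists_reduction
  obtain rfl : d = 1 := by
    rw [hdim] at hd
    exact_mod_cast hd.symm
  have hs : Set.range s = {s 0} := by rw [Set.range_unique]; rfl
  rw [hs] at hQI hne hsq
  exact ⟨s 0, hQI (Ideal.mem_span_singleton_self _), hne, hsq⟩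

theorem IsUlrichIdeal.ne_top {I : Ideal A} (hI : IsUlrichIdeal I) : I ≠ ⊤ := by
  rintro rfl
  exact (maximalIdeal.isMaximal A).ne_top (by rw [← hI.radical_eq, Ideal.radical_top])

theorem IsUlrichIdeal.ne_span_singleton [IsDomain A] (hdim : ringKrullDim A = 1) {I : Ideal A}
    (hI : IsUlrichIdeal I) (b : A) : I ≠ Ideal.span {b} := by
  rintro rfl
  obtain ⟨a, ha, hne, hsq⟩ := hI.exists_sq_eq_span_singleton_mul hdim
  have hb : b ≠ 0 := by
    rintro rfl
    obtain ⟨c, rfl⟩ := Ideal.mem_span_singleton.mp ha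
    simp at hne
  have h1 : b * b ∈ Ideal.span {a} * Ideal.span {b} := by
    rw [← hsq, pow_two]
    exact Ideal.mul_mem_mul (Ideal.mem_span_singleton_self b) (Ideal.mem_span_singleton_self b)
  rw [Ideal.span_singleton_mul_span_singleton, Ideal.mem_span_singleton] at h1
  refine hne (le_antisymm ?_ ((Ideal.span_singleton_le_iff_mem _).mpr ha))
  rw [Ideal.span_singleton_le_iff_mem, Ideal.mem_span_singleton]
  exact (mul_dvd_mul_iff_right hb).mp h1

/-- If `I / I²` is free, then a minimal generator `v` of `I` has a unit coordinate; comparing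
coordinates in a relation `y v = x w` shows that `y` is a multiple of `x` modulo `I`. -/
theorem Ideal.exists_sub_mul_mem_of_free_cotangent {I : Ideal A} (hne : I ≠ ⊤)
    [Module.Free (A ⧸ I) I.Cotangent] {v w x y : A} (hv : v ∈ I) (hv' : v ∉ maximalIdeal A • I)
    (hw : w ∈ I) (hyv : y * v = x * w) : ∃ c, y - x * c ∈ I := by
  let b := Module.Free.chooseBasis (A ⧸ I) I.Cotangent
  obtain ⟨i, hi⟩ : ∃ i, IsUnit (b.repr (I.toCotangent ⟨v, hv⟩) i) := by
    by_contra! hu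
    have hc : ∀ i, ∃ c ∈ maximalIdeal A,
        Ideal.Quotient.mk I c = b.repr (I.toCotangent ⟨v, hv⟩) i := fun i => by
      obtain ⟨c, hc⟩ := Ideal.Quotient.mk_surjective (b.repr (I.toCotangent ⟨v, hv⟩) i)
      exact ⟨c, fun hcu => hu i (hc ▸ hcu.map _), hc⟩
    choose c hcm hc using hc
    choose E hE using fun i => I.toCotangent_surjective (b i)
    have h1 : I.toCotangent ⟨v, hv⟩ =
        I.toCotangent (∑ i ∈ (b.repr (I.toCotangent ⟨v, hv⟩)).support, c i • E i) := by
      conv_lhs => rw [← b.linearCombination_repr (I.toCotangent ⟨v, hv⟩)]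
      rw [map_sum, Finsupp.linearCombination_apply, Finsupp.sum]
      refine Finset.sum_congr rfl fun i _ => ?_
      rw [map_smul, hE, ← hc]
      rfl
    rw [I.toCotangent_eq] at h1
    have h2 : I ^ 2 ≤ maximalIdeal A • I := by
      rw [pow_two, smul_eq_mul]
      exact Ideal.mul_mono_left (le_maximalIdeal hne)
    refine hv' ((Submodule.sub_mem_iff_left _ ?_).mp (h2 h1))
    rw [AddSubmonoidClass.coe_finsetSum]
    exact Submodule.sum_mem _ fun i _ => Submodule.smul_mem_smul (hcm i) (E i).2
  have h1 : y • I.toCotangent ⟨v, hv⟩ = x • I.toCotangent ⟨w, hw⟩ := by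
    rw [← map_smul, ← map_smul]
    exact congrArg _ (Subtype.ext (by simpa using hyv))
  have h2 : Ideal.Quotient.mk I y * b.repr (I.toCotangent ⟨v, hv⟩) i =
      Ideal.Quotient.mk I x * b.repr (I.toCotangent ⟨w, hw⟩) i := by
    have h3 : Ideal.Quotient.mk I y • I.toCotangent ⟨v, hv⟩ =
      Ideal.Quotient.mk I x • I.toCotangent ⟨w, hw⟩ := h1
    simpa using congrArg (fun z => b.repr z i) h3
  obtain ⟨s, hs⟩ := hi.exists_right_inv
  obtain ⟨c, hc⟩ := Ideal.Quotient.mk_surjective (b.repr (I.toCotangent ⟨w, hw⟩) i * s)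
  refine ⟨c, ?_⟩
  rw [← Ideal.Quotient.mk_eq_mk_iff_sub_mem, map_mul, hc]
  linear_combination s * h2 - Ideal.Quotient.mk I y * hs

end Reduction

namespace IsCuspExtension

open IsLocalRing

variable {k A : Type*} [Field k] [CommRing A] [IsLocalRing A] [Algebra k⟦X⟧ A]
  {ℓ : ℕ} {y : A}

local notation "ι" => algebraMap k⟦X⟧ A

theorem nonempty_basis (h : IsCuspExtension (k := k) ℓ y) :
    Nonempty (Module.Basis (Fin 3) k⟦X⟧ A) := by
  refine ⟨Module.Basis.mk (v := ![1, y, y ^ 2]) ?_ ?_⟩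
  · rw [Fintype.linearIndependent_iff]
    intro f hf
    rw [Fin.sum_univ_three] at hf
    obtain ⟨h0, h1, h2⟩ := h.coord_eq_zero (f 0) (f 1) (f 2) (by
      rw [← hf]
      simp [Algebra.smul_def])
    intro i
    fin_cases i <;> assumption
  · rintro a -
    obtain ⟨f₀, f₁, f₂, rfl⟩ := h.exists_coord a
    have h0 : (1 : A) ∈ Submodule.span k⟦X⟧ (Set.range ![1, y, y ^ 2]) :=
      Submodule.subset_span ⟨0, rfl⟩
    have h1 : y ∈ Submodule.span k⟦X⟧ (Set.range ![1, y, y ^ 2]) :=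
      Submodule.subset_span ⟨1, rfl⟩
    have h2 : y ^ 2 ∈ Submodule.span k⟦X⟧ (Set.range ![1, y, y ^ 2]) :=
      Submodule.subset_span ⟨2, rfl⟩
    rw [← mul_one (ι f₀)]
    simp only [← Algebra.smul_def]
    exact add_mem (add_mem (Submodule.smul_mem _ _ h0) (Submodule.smul_mem _ _ h1))
      (Submodule.smul_mem _ _ h2)

/-- A non-principal ideal `I` of `A` has a minimal generator `v` with `y v ∈ X I`. Indeed `y`
acts on the space `I / X I`, which has dimension at most three; its cokernel
`I / (X, y) I` has dimension at least two, hence so has its kernel, while its image has dimension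
at most one. -/
theorem exists_minimal_generator (h : IsCuspExtension (k := k) ℓ y) (hℓ : ℓ ≠ 0) {I : Ideal A}
    (hnp : ∀ a, I ≠ Ideal.span {a}) :
    ∃ v ∈ I, v ∉ maximalIdeal A • I ∧ ∃ w ∈ I, y * v = ι X * w := by
  classical
  by_contra! hcon
  let _ : Algebra k A := Algebra.compHom A (C : k →+* k⟦X⟧)
  have hCA : ∀ c : k, algebraMap k A c = ι (C c) := fun c => rfl
  obtain ⟨B⟩ := h.nonempty_basis
  have := Module.Finite.of_basis B
  obtain ⟨n, b⟩ := Submodule.basisOfPid B (I.restrictScalars k⟦X⟧)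
  have hn : n ≤ 3 := by
    have h1 := Submodule.finrank_le (I.restrictScalars k⟦X⟧)
    rwa [Module.finrank_eq_card_basis b, Module.finrank_eq_card_basis B, Fintype.card_fin,
      Fintype.card_fin] at h1
  have hb : ∀ v ∈ I, ∃ f : Fin n → k⟦X⟧, v = ∑ i, ι (f i) * (b i : A) := fun v hv => by
    refine ⟨b.repr ⟨v, hv⟩, (congrArg Subtype.val (b.sum_repr ⟨v, hv⟩)).symm.trans ?_⟩
    rw [AddSubmonoidClass.coe_finsetSum]
    exact Finset.sum_congr rfl fun i _ => Algebra.smul_def _ _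
  have hfg : I.FG := by
    refine ⟨Finset.univ.image fun i => (b i : A), le_antisymm (Ideal.span_le.mpr ?_) ?_⟩
    · intro z hz
      obtain ⟨i, -, rfl⟩ := Finset.mem_image.mp hz
      exact (b i).2
    · intro v hv
      obtain ⟨f, rfl⟩ := hb v hv
      exact Ideal.sum_mem _ fun i _ => Ideal.mul_mem_left _ _ (Ideal.subset_span (by simp))
  -- multiplication by an element of `A` as a `k`-linear endomorphism of `I`
  let M : A → (I →ₗ[k] I) := fun a => (LinearMap.lsmul A I a).restrictScalars k
  have hM : ∀ a v, (M a v : A) = a * v := fun a v => rfl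
  let W : Submodule k I := LinearMap.range (M (ι X))
  have hW : W ≤ W.comap (M y) := by
    rintro _ ⟨v, rfl⟩
    exact ⟨M y v, Subtype.ext (by simp only [hM]; ring)⟩
  let T : (I ⧸ W) →ₗ[k] (I ⧸ W) := W.mapQ W (M y) hW
  have hmI : ∀ v ∈ maximalIdeal A • I, ∃ r ∈ I, ∃ s ∈ I, v = ι X * r + y * s := by
    intro v hv
    refine Submodule.smul_induction_on hv (fun a ha v hv => ?_) ?_
    · obtain ⟨p, q, rfl⟩ := h.exists_eq_of_mem_maximalIdeal hℓ ha
      exact ⟨p * v, I.mul_mem_left _ hv, q * v, I.mul_mem_left _ hv, by rw [smul_eq_mul]; ring⟩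
    · rintro _ _ ⟨r, hr, s, hs, rfl⟩ ⟨r', hr', s', hs', rfl⟩
      exact ⟨r + r', add_mem hr hr', s + s', add_mem hs hs', by ring⟩
  have hspan : Submodule.span k (Set.range fun i => W.mkQ ⟨b i, (b i).2⟩) = ⊤ := by
    rw [eq_top_iff]
    rintro z -
    obtain ⟨⟨v, hv⟩, rfl⟩ := W.mkQ_surjective z
    obtain ⟨f, rfl⟩ := hb v hv
    choose q hq using fun i => (X_dvd_iff (φ := f i - C (constantCoeff (f i)))).mpr (by simp)
    have hf : ∀ i, f i = C (constantCoeff (f i)) + X * q i := fun i => by rw [← hq]; ring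
    have : W.mkQ ⟨∑ i, ι (f i) * (b i : A), hv⟩ =
        ∑ i, constantCoeff (f i) • W.mkQ ⟨b i, (b i).2⟩ := by
      simp only [← map_smul, ← map_sum]
      rw [← sub_eq_zero, ← map_sub, Submodule.mkQ_apply, Submodule.Quotient.mk_eq_zero]
      refine ⟨∑ i, M (ι (q i)) ⟨b i, (b i).2⟩, Subtype.ext ?_⟩
      simp only [hM, AddSubgroupClass.coe_sub, AddSubmonoidClass.coe_finsetSum,
        Submodule.coe_smul_of_tower, Algebra.smul_def, hCA]
      rw [Finset.mul_sum, ← Finset.sum_sub_distrib]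
      refine Finset.sum_congr rfl fun i _ => ?_
      conv_rhs => rw [hf i]
      simp only [map_add, map_mul, constantCoeff_C, constantCoeff_X, zero_mul, add_zero]
      ring
    rw [this]
    exact Submodule.sum_mem _ fun i _ => Submodule.smul_mem _ _ (Submodule.subset_span ⟨i, rfl⟩)
  have hfin : Module.Finite k (I ⧸ W) := ⟨hspan ▸ Submodule.fg_span (Set.finite_range _)⟩
  have hdim : Module.finrank k (I ⧸ W) ≤ 3 := by
    have h1 := finrank_range_le_card (R := k) (fun i => W.mkQ ⟨b i, (b i).2⟩)
    rw [Set.finrank, hspan, finrank_top, Fintype.card_fin] at h1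
    omega
  have hker : LinearMap.ker T ≤ LinearMap.range T := by
    intro z hz
    obtain ⟨⟨v, hv⟩, rfl⟩ := W.mkQ_surjective z
    rw [LinearMap.mem_ker, Submodule.mkQ_apply, Submodule.mapQ_apply,
      Submodule.Quotient.mk_eq_zero] at hz
    obtain ⟨⟨w, hw⟩, hwv⟩ := hz
    have h1 : v ∈ maximalIdeal A • I := by
      by_contra h2
      exact hcon v hv h2 w hw (congrArg Subtype.val hwv).symm
    obtain ⟨r, hr, s, hs, rfl⟩ := hmI v h1
    refine ⟨W.mkQ ⟨s, hs⟩, ?_⟩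
    rw [Submodule.mkQ_apply, Submodule.mkQ_apply, Submodule.mapQ_apply, Submodule.Quotient.eq]
    exact ⟨⟨-r, neg_mem hr⟩, Subtype.ext (by
      simp only [hM, AddSubgroupClass.coe_sub]
      ring)⟩
  have hcok : Module.finrank k ((I ⧸ W) ⧸ LinearMap.range T) ≤ 1 := by
    have h1 := LinearMap.finrank_range_add_finrank_ker T
    have h2 := Submodule.finrank_mono hker
    have h3 := Submodule.finrank_quotient_add_finrank (LinearMap.range T)
    omega
  obtain ⟨z, hz⟩ := finrank_le_one_iff.mp hcok
  obtain ⟨z, rfl⟩ := Submodule.mkQ_surjective _ z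
  obtain ⟨⟨v, hv⟩, rfl⟩ := W.mkQ_surjective z
  refine hnp v (Ideal.exists_eq_span_singleton_of_le_sup hfg hv fun u hu => ?_)
  obtain ⟨c, hc⟩ := hz (Submodule.mkQ _ (W.mkQ ⟨u, hu⟩))
  rw [← map_smul, ← map_smul, ← sub_eq_zero, ← map_sub, ← map_sub, Submodule.mkQ_apply,
    Submodule.Quotient.mk_eq_zero] at hc
  obtain ⟨t, ht⟩ := hc
  obtain ⟨⟨s, hs⟩, rfl⟩ := W.mkQ_surjective t
  rw [Submodule.mkQ_apply, Submodule.mkQ_apply, Submodule.mapQ_apply, Submodule.Quotient.eq] at ht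
  obtain ⟨⟨r, hr⟩, hr'⟩ := ht
  have h4 : ι X * r = y * s - (algebraMap k A c * v - u) := by
    have := congrArg Subtype.val hr'
    simpa only [hM, AddSubgroupClass.coe_sub, Submodule.coe_smul_of_tower, Algebra.smul_def]
      using this
  have h5 : u = algebraMap k A c * v + (ι X * r - y * s) := by linear_combination -h4
  rw [h5]
  refine Submodule.add_mem_sup (Ideal.mul_mem_left _ _ (Ideal.mem_span_singleton_self v))
    (sub_mem (Submodule.smul_mem_smul h.X_mem hr) (Submodule.smul_mem_smul (h.y_mem hℓ) hs))

/-- If `y` is a multiple of `X` modulo `I`, then `A / I` is a quotient of `k⟦X⟧`. -/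
theorem exists_sub_algebraMap_mem (h : IsCuspExtension (k := k) ℓ y) {I : Ideal A} {c : A}
    (hc : y - ι X * c ∈ I) : ∃ g : k⟦X⟧, y - ι g ∈ I := by
  obtain ⟨B⟩ := h.nonempty_basis
  have := Module.Finite.of_basis B
  have hle : (⊤ : Submodule k⟦X⟧ A) ≤
      LinearMap.range (Algebra.linearMap k⟦X⟧ A) ⊔ I.restrictScalars k⟦X⟧ := by
    refine Submodule.le_of_le_smul_of_le_jacobson_bot Module.Finite.fg_top
      (maximalIdeal_le_jacobson ⊥) ?_
    rintro a -
    obtain ⟨f₀, f₁, f₂, rfl⟩ := h.exists_coord a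
    have : ι f₀ + ι f₁ * y + ι f₂ * y ^ 2 =
        (ι f₀ + (ι f₁ + ι f₂ * y) * (y - ι X * c)) +
          (X : k⟦X⟧) • ((ι f₁ + ι f₂ * y) * c) := by
      rw [Algebra.smul_def]
      ring
    rw [this]
    refine Submodule.add_mem_sup (Submodule.add_mem_sup ⟨f₀, rfl⟩ (I.mul_mem_left _ hc))
      (Submodule.smul_mem_smul ?_ trivial)
    rw [mem_maximalIdeal, mem_nonunits_iff, isUnit_iff_not_X_dvd, not_not]
  obtain ⟨_, ⟨g, rfl⟩, z, hz, hgz⟩ := Submodule.mem_sup.mp (hle (Submodule.mem_top (x := y)))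
  refine ⟨g, ?_⟩
  rw [← hgz]
  simpa using hz

theorem exists_eq_span_pair [IsDomain A] (h : IsCuspExtension (k := k) ℓ y) {I : Ideal A}
    (hbot : I ≠ ⊥) (htop : I ≠ ⊤) {g : k⟦X⟧} (hg : y - ι g ∈ I) :
    ∃ m ≠ 0, X ^ m ∣ g ^ 3 - X ^ ℓ ∧ I = Ideal.span {y - ι g, ι (X ^ m)} := by
  classical
  obtain ⟨a, ha, ha0⟩ := Submodule.exists_mem_ne_zero_of_ne_bot hbot
  have hex := h.exists_X_pow_mem ha ha0
  have hmem := Nat.find_spec hex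
  have hdvd : ∀ f : k⟦X⟧, ι f ∈ I → X ^ Nat.find hex ∣ f := fun f hf => by
    rcases eq_or_ne f 0 with rfl | hf0
    · exact dvd_zero _
    obtain ⟨n, u, hu, rfl⟩ := exists_eq_X_pow_mul_isUnit hf0
    rw [map_mul] at hf
    rw [X_pow_dvd_X_pow_mul_isUnit hu]
    exact Nat.find_min' hex ((Ideal.mul_unit_mem_iff_mem _ (hu.map ι)).mp hf)
  refine ⟨Nat.find hex, fun h0 => htop ?_, hdvd _ ?_, le_antisymm (fun a ha => ?_) ?_⟩
  · rw [Ideal.eq_top_iff_one]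
    rwa [h0, pow_zero, map_one] at hmem
  · have : ι (g ^ 3 - X ^ ℓ) = -(y ^ 2 + y * ι g + ι g ^ 2) * (y - ι g) := by
      rw [map_sub, ← h.pow_three, map_pow]
      ring
    rw [this]
    exact I.mul_mem_left _ hg
  · obtain ⟨f₀, f₁, f₂, rfl⟩ := h.exists_coord a
    have h1 : ι f₀ + ι f₁ * y + ι f₂ * y ^ 2 =
        (ι f₁ + ι f₂ * (y + ι g)) * (y - ι g) + ι (f₀ + f₁ * g + f₂ * g ^ 2) := by
      simp only [map_add, map_mul, map_pow]
      ring
    rw [h1] at ha ⊢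
    have h2 := hdvd _ ((Submodule.add_mem_iff_right _ (I.mul_mem_left _ hg)).mp ha)
    exact add_mem (Ideal.mul_mem_left _ _ (Ideal.subset_span (by simp)))
      (Ideal.mem_of_dvd _ (map_dvd ι h2) (Ideal.subset_span (by simp)))
  · rw [Ideal.span_le]
    rintro z (rfl | rfl)
    exacts [hg, hmem]

end IsCuspExtension

namespace PowerSeries

variable {k : Type*} [Field k]

theorem exists_isUnit_eq_X_pow_mul_iff {n : ℕ} {f : k⟦X⟧} :
    (∃ ε, IsUnit ε ∧ f = X ^ n * ε) ↔ X ^ n ∣ f ∧ ¬ X ^ (n + 1) ∣ f := by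
  constructor
  · rintro ⟨ε, hε, rfl⟩
    simp [X_pow_dvd_X_pow_mul_isUnit hε]
  · rintro ⟨⟨ε, rfl⟩, h⟩
    refine ⟨ε, isUnit_iff_not_X_dvd.mpr fun hX => h ?_, rfl⟩
    rw [pow_succ]
    exact mul_dvd_mul_left _ hX

/-- The solutions `g` of `ord (g³ - X ^ ℓ) = 2 m`. -/
theorem exists_isUnit_cube_sub_iff {ℓ m : ℕ} (hℓ : ¬ 3 ∣ ℓ) {g : k⟦X⟧} :
    (∃ ε, IsUnit ε ∧ g ^ 3 - X ^ ℓ = X ^ (2 * m) * ε) ↔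
      (2 * m = ℓ ∧ X ^ ℓ ∣ g ^ 3) ∨
        ∃ (i : ℕ) (u : k⟦X⟧), IsUnit u ∧ m = 3 * i ∧ 6 * i < ℓ ∧ g = X ^ (2 * i) * u := by
  rw [exists_isUnit_eq_X_pow_mul_iff, X_pow_dvd_cube_sub hℓ, X_pow_dvd_cube_sub hℓ]
  constructor
  · rintro ⟨⟨h1, h2⟩, h3⟩
    rcases h2.eq_or_lt with h2 | h2
    · exact Or.inl ⟨h2, h2 ▸ h1⟩
    have h3 : ¬ X ^ (2 * m + 1) ∣ g ^ 3 := fun h => h3 ⟨h, h2⟩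
    have hg0 : g ≠ 0 := by
      rintro rfl
      simp at h3
    obtain ⟨v, u, hu, rfl⟩ := exists_eq_X_pow_mul_isUnit hg0
    rw [mul_pow, ← pow_mul, X_pow_dvd_X_pow_mul_isUnit (hu.pow _)] at h1 h3
    obtain ⟨i, rfl⟩ : ∃ i, v = 2 * i := ⟨v / 2, by omega⟩
    exact Or.inr ⟨i, u, hu, by omega, by omega, rfl⟩
  · rintro (⟨rfl, h⟩ | ⟨i, u, hu, rfl, hi, rfl⟩)
    · exact ⟨⟨h, le_rfl⟩, fun h' => by omega⟩
    · rw [mul_pow, ← pow_mul, X_pow_dvd_X_pow_mul_isUnit (hu.pow _),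
        X_pow_dvd_X_pow_mul_isUnit (hu.pow _)]
      omega

end PowerSeries

namespace IsCuspExtension

/-! ### Every Ulrich ideal has the form `(y - g, X ^ m)` -/

open IsLocalRing

variable {k A : Type*} [Field k] [CommRing A] [IsLocalRing A] [Algebra k⟦X⟧ A]
  {ℓ : ℕ} {y : A}

local notation "ι" => algebraMap k⟦X⟧ A

theorem exists_coord_of_mem_span_pair (h : IsCuspExtension (k := k) ℓ y) {m : ℕ} {g : k⟦X⟧}
    (hg : X ^ m ∣ g ^ 3 - X ^ ℓ) {a : A} (ha : a ∈ Ideal.span {y - ι g, ι (X ^ m)}) :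
    ∃ p q r : k⟦X⟧, a = ι (X ^ m * p) + ι q * (y - ι g) + ι r * (y - ι g) ^ 2 := by
  obtain ⟨f₀, f₁, f₂, rfl⟩ := h.exists_coord_sub g a
  have hw : y - ι g ∈ Ideal.span {y - ι g, ι (X ^ m)} := Ideal.subset_span (by simp)
  have h1 : ι f₀ ∈ Ideal.span {y - ι g, ι (X ^ m)} := by
    have h2 : ι f₀ = ι f₀ + ι f₁ * (y - ι g) + ι f₂ * (y - ι g) ^ 2 -
      (ι f₁ + ι f₂ * (y - ι g)) * (y - ι g) := by ring
    rw [h2]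
    exact sub_mem ha (Ideal.mul_mem_left _ _ hw)
  obtain ⟨p, rfl⟩ := (h.algebraMap_mem_span_pair_iff hg).mp h1
  exact ⟨p, f₁, f₂, rfl⟩

/-- If the order of `g³ - X ^ ℓ` exceeds `2 m`, then `I = (y - g, X ^ m)` has no principal
reduction with reduction number one. With `w = y - g`, the three elements `X ^ (2 * m)`,
`X ^ m * w`, `w²` are then minimal generators of `I²`; modulo the maximal ideal, the product
`(p X ^ m + q w) (s X ^ m + t w)` has coordinates `(p s, p t + q s, q t)`, and no linear form
`p X ^ m + q w` divides both `w²` and `X ^ (2 * m)`. -/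
theorem sq_ne_span_singleton_mul (h : IsCuspExtension (k := k) ℓ y) (hℓ : ¬ 3 ∣ ℓ) {m : ℕ}
    (hm : m ≠ 0) {g : k⟦X⟧} (hg : X ^ (2 * m + 1) ∣ g ^ 3 - X ^ ℓ) {a : A}
    (ha : a ∈ Ideal.span {y - ι g, ι (X ^ m)}) :
    Ideal.span {y - ι g, ι (X ^ m)} ^ 2 ≠ Ideal.span {a} * Ideal.span {y - ι g, ι (X ^ m)} := by
  intro hsq
  have hg' : X ^ m ∣ g ^ 3 - X ^ ℓ := (pow_dvd_pow _ (by omega)).trans hg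
  have hg3 := ((X_pow_dvd_cube_sub hℓ).mp hg).1
  obtain ⟨g₁, hg₁⟩ : X ∣ g := by
    simpa using X_pow_dvd_pow_of_cube 1 (M := 1) hg3 (fun v hv => by omega) one_ne_zero
  obtain ⟨d, hd⟩ : X ^ (m + 1) ∣ g ^ 2 :=
    X_pow_dvd_pow_of_cube 2 hg3 (fun v hv => by omega) two_ne_zero
  obtain ⟨e, he⟩ := hg
  have hcube := h.sub_cube g
  have hwI : y - ι g ∈ Ideal.span {y - ι g, ι (X ^ m)} := Ideal.subset_span (by simp)
  have hXI : ι (X ^ m) ∈ Ideal.span {y - ι g, ι (X ^ m)} := Ideal.subset_span (by simp)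
  have hcoord := fun {b : A} => h.exists_coord_of_mem_span_pair hg' (a := b)
  have huniq := fun {f₀ f₁ f₂ : k⟦X⟧} => h.coord_sub_eq_zero g (f₀ := f₀) (f₁ := f₁) (f₂ := f₂)
  rw [he, hd] at hcube
  generalize hI : Ideal.span {y - ι g, ι (X ^ m)} = I at *
  generalize y - ι g = w at *
  rw [hg₁] at hcube
  obtain ⟨p, q, r, rfl⟩ := hcoord ha
  have hprod : ∀ b ∈ I, ∃ s t : k, ∃ c₀ c₁ c₂ : k⟦X⟧,
      (ι (X ^ m * p) + ι q * w + ι r * w ^ 2) * b =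
        ι (X ^ (2 * m) * c₀) + ι (X ^ m * c₁) * w + ι c₂ * w ^ 2 ∧
      constantCoeff c₀ = constantCoeff p * s ∧
      constantCoeff c₁ = constantCoeff p * t + constantCoeff q * s ∧
      constantCoeff c₂ = constantCoeff q * t := by
    intro b hb
    obtain ⟨s, t, u, rfl⟩ := hcoord hb
    refine ⟨constantCoeff s, constantCoeff t,
      p * s - X * e * (q * u + r * t) + r * u * X ^ 2 * (3 * g₁) * e,
      p * t + q * s - X * (3 * d) * (q * u + r * t) + r * u * X ^ 2 * (3 * g₁) * (3 * d) -
        r * u * X ^ m * X * e,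
      q * t + X ^ m * (p * u + r * s) - X * (3 * g₁) * (q * u + r * t) +
        r * u * (X ^ 2 * (3 * g₁) ^ 2 - X ^ m * X * (3 * d)), ?_, ?_, ?_, ?_⟩
    · simp only [map_add, map_sub, map_mul, map_pow, map_ofNat] at hcube ⊢
      linear_combination (ι q * ι u + ι r * ι t + ι r * ι u * w -
        ι r * ι u * ι X * (3 * ι g₁)) * hcube
    · simp
    · simp [hm]
    · simp [hm]
  have hex : ∀ c ∈ I ^ 2, ∃ b ∈ I, (ι (X ^ m * p) + ι q * w + ι r * w ^ 2) * b = c := by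
    intro c hc
    rwa [hsq, Ideal.mem_span_singleton_mul] at hc
  obtain ⟨b, hb, hbw⟩ := hex (w ^ 2) (Ideal.pow_mem_pow hwI 2)
  obtain ⟨s, t, c₀, c₁, c₂, hc, h0, h1, h2⟩ := hprod b hb
  obtain ⟨-, -, e2⟩ := huniq (f₀ := X ^ (2 * m) * c₀) (f₁ := X ^ m * c₁) (f₂ := c₂ - 1) (by
    rw [map_sub, map_one]
    linear_combination hbw - hc)
  have hq : constantCoeff q ≠ 0 := by
    intro hq
    rw [sub_eq_zero.mp e2, hq, zero_mul, map_one] at h2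
    exact one_ne_zero h2
  clear hbw hc h0 h1 h2 e2
  obtain ⟨b, hb, hbw⟩ := hex (ι (X ^ m) ^ 2) (Ideal.pow_mem_pow hXI 2)
  obtain ⟨s, t, c₀, c₁, c₂, hc, h0, h1, h2⟩ := hprod b hb
  obtain ⟨e0, e1, e2⟩ := huniq (f₀ := X ^ (2 * m) * (c₀ - 1)) (f₁ := X ^ m * c₁) (f₂ := c₂) (by
    rw [mul_sub, map_sub, mul_one]
    rw [← map_pow, ← pow_mul, mul_comm m] at hbw
    linear_combination hbw - hc)
  have e0 := (mul_eq_zero.mp e0).resolve_left (pow_ne_zero _ X_ne_zero)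
  have e1 := (mul_eq_zero.mp e1).resolve_left (pow_ne_zero _ X_ne_zero)
  rw [sub_eq_zero.mp e0, map_one] at h0
  rw [e1, map_zero] at h1
  rw [e2, map_zero] at h2
  have ht : t = 0 := (mul_eq_zero.mp h2.symm).resolve_left hq
  rw [ht, mul_zero, zero_add] at h1
  have hs : s = 0 := (mul_eq_zero.mp h1.symm).resolve_left hq
  rw [hs, mul_zero] at h0
  exact one_ne_zero h0

variable [IsDomain A]

theorem isUlrichIdeal_iff (h : IsCuspExtension (k := k) ℓ y) (hℓ : ¬ 3 ∣ ℓ) {I : Ideal A} :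
    IsUlrichIdeal I ↔ ∃ m ≠ 0, ∃ g : k⟦X⟧,
      (∃ ε, IsUnit ε ∧ g ^ 3 - X ^ ℓ = X ^ (2 * m) * ε) ∧
        I = Ideal.span {y - ι g, ι (X ^ m)} := by
  constructor
  · intro hI
    have hℓ0 : ℓ ≠ 0 := by rintro rfl; simp at hℓ
    have hdim := h.ringKrullDim_eq_one hℓ0
    have hnp := hI.ne_span_singleton hdim
    have := hI.free_cotangent
    obtain ⟨v, hv, hv', w, hw, hvw⟩ := h.exists_minimal_generator hℓ0 hnp
    obtain ⟨c, hc⟩ := Ideal.exists_sub_mul_mem_of_free_cotangent hI.ne_top hv hv' hw hvw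
    obtain ⟨g, hg⟩ := h.exists_sub_algebraMap_mem hc
    have hbot : I ≠ ⊥ := by simpa using hnp 0
    obtain ⟨m, hm, hgm, hspan⟩ := h.exists_eq_span_pair hbot hI.ne_top hg
    refine ⟨m, hm, g, exists_isUnit_eq_X_pow_mul_iff.mpr ⟨?_, fun hX => ?_⟩, hspan⟩
    -- the cubic equation of `y - g` is a relation between the generators of `I`, so that its
    -- coefficients lie in `I`
    · obtain ⟨e, he⟩ := hgm
      have hXI : ι (X ^ m) ∈ I := hspan ▸ Ideal.subset_span (by simp)
      have hli := (Ideal.linearIndependent_toCotangent_pair_iff hg hXI).mp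
        (Ideal.linearIndependent_toCotangent_pair hspan hg hXI hI.ne_top hnp)
      have heI := (hli ((y - ι g) ^ 2 + ι (3 * g) * (y - ι g) + ι (3 * g ^ 2)) (ι e) (by
        have h0 := h.sub_cube g
        rw [he, map_mul ι (X ^ m)] at h0
        convert (I ^ 2).zero_mem using 1
        linear_combination h0)).2
      rw [hspan, h.algebraMap_mem_span_pair_iff ⟨e, he⟩] at heI
      rw [he, two_mul, pow_add]
      exact mul_dvd_mul_left _ heI
    · obtain ⟨a, ha, -, hsq⟩ := hI.exists_sq_eq_span_singleton_mul hdim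
      rw [hspan] at ha hsq
      exact h.sq_ne_span_singleton_mul hℓ hm hX ha hsq
  · rintro ⟨m, hm, g, ⟨ε, hε, hg⟩, rfl⟩
    exact h.isUlrichIdeal_span_pair hℓ hm hε hg

end IsCuspExtension

/-! ### Truncated power series -/

namespace PowerSeries

variable {k : Type*} [Field k]

/-- The polynomial `∑ αⱼ X ^ j` of degree less than `n`, as a power series. -/
noncomputable def ofFin {n : ℕ} (α : Fin n → k) : k⟦X⟧ := ∑ j : Fin n, C (α j) * X ^ (j : ℕ)

theorem coeff_ofFin {n : ℕ} (α : Fin n → k) (j : Fin n) : coeff (j : ℕ) (ofFin α) = α j := by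
  rw [ofFin, map_sum, Finset.sum_eq_single j]
  · simp
  · intro i _ hij
    rw [coeff_C_mul, coeff_X_pow, if_neg (fun h => hij (Fin.ext h.symm)), mul_zero]
  · simp

theorem exists_X_pow_dvd_sub_ofFin (f : k⟦X⟧) (n : ℕ) :
    ∃ α : Fin n → k, X ^ n ∣ f - ofFin α := by
  refine ⟨fun j => coeff (j : ℕ) f, X_pow_dvd_iff.mpr fun j hj => ?_⟩
  rw [map_sub, coeff_ofFin _ ⟨j, hj⟩, sub_self]

theorem ofFin_injective_mod {n : ℕ} {α β : Fin n → k} (h : X ^ n ∣ ofFin α - ofFin β) : α = β := by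
  ext j
  have := X_pow_dvd_iff.mp h j j.2
  rwa [map_sub, coeff_ofFin, coeff_ofFin, sub_eq_zero] at this

theorem constantCoeff_ofFin {n : ℕ} (α : Fin n → k) (hn : 0 < n) :
    constantCoeff (ofFin α) = α ⟨0, hn⟩ := by
  rw [← coeff_zero_eq_constantCoeff_apply]
  exact coeff_ofFin α ⟨0, hn⟩

/-- Inverses of congruent units are congruent. -/
theorem X_pow_dvd_sub_iff_of_mul_eq_one {n : ℕ} {f f' v v' : k⟦X⟧} (h : f * v = 1)
    (h' : f' * v' = 1) : X ^ n ∣ f - f' ↔ X ^ n ∣ v - v' := by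
  constructor <;> rintro ⟨c, hc⟩
  · exact ⟨-c * v * v', by linear_combination -v * v' * hc + v' * h - v * h'⟩
  · exact ⟨-c * f * f', by linear_combination -f * f' * hc + f' * h - f * h'⟩

end PowerSeries

/-! ### The ring `k[[t³, t^ℓ]]` as an extension of `k[[t³]]` -/

namespace IsCuspExtension

variable {k A : Type*} [Field k] [CommRing A] [Algebra k⟦X⟧ A]

local notation "ι" => algebraMap k⟦X⟧ A

theorem span_pair_congr {y : A} {m : ℕ} {g g' : k⟦X⟧} (h : X ^ m ∣ g - g') :
    (Ideal.span {y - ι g, ι (X ^ m)} : Ideal A) = Ideal.span {y - ι g', ι (X ^ m)} := by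
  obtain ⟨c, hc⟩ := h
  have : y - ι g = y - ι g' + -ι c * ι (X ^ m) := by
    have := congrArg ι hc
    rw [map_sub, map_mul] at this
    linear_combination -this
  rw [this, Ideal.span_pair_add_mul_right]

/-- Multiplying the first generator by the inverse `v` of `f` turns the second normal form into
`(y - g, X ^ m)` with `g = -X ^ (2 * i) * v` and `m = 3 * i`. -/
theorem span_X_pow_add_mul {y : A} {i : ℕ} {f v : k⟦X⟧} (h : f * v = 1) :
    (Ideal.span {ι (X ^ (2 * i)) + ι f * y, ι (X ^ i) * y} : Ideal A) =
      Ideal.span {y - ι (-X ^ (2 * i) * v), ι (X ^ (3 * i))} := by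
  have hv : ι f * ι v = 1 := by rw [← map_mul, h, map_one]
  refine le_antisymm ?_ ?_ <;> rw [Ideal.span_le] <;> rintro z (rfl | rfl) <;>
    rw [SetLike.mem_coe, Ideal.mem_span_pair] <;> simp only [map_mul, map_neg, map_pow]
  · exact ⟨ι f, 0, by linear_combination ι X ^ (2 * i) * hv⟩
  · exact ⟨ι X ^ i, -ι v, by ring⟩
  · exact ⟨ι v, 0, by linear_combination y * hv⟩
  · exact ⟨ι X ^ i, -ι f, by ring⟩

end IsCuspExtension

section RingThree

variable {k : Type*} [Field k] {ℓ : ℕ}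

theorem mem_semigroupThree_imp {n : ℕ} (hn : n ∈ semigroupThree ℓ) :
    3 ∣ n ∨ (ℓ ≤ n ∧ 3 ∣ n - ℓ) ∨ (2 * ℓ ≤ n ∧ 3 ∣ n - 2 * ℓ) := by
  induction hn using AddSubmonoid.closure_induction with
  | mem x hx => rcases hx with rfl | rfl <;> simp
  | zero => simp
  | add x y _ _ hx hy => omega

/-- The ring `k[[t³, t^ℓ]]` is an algebra over `k⟦X⟧` through `X ↦ t³`. -/
noncomputable instance ringThreeAlgebra : Algebra k⟦X⟧ (ringThree k ℓ) :=
  ((expand 3 three_ne_zero : k⟦X⟧ →ₐ[k] k⟦X⟧).codRestrict (ringThree k ℓ) fun f n hn => by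
    refine coeff_expand_of_not_dvd 3 _ f fun ⟨m, hm⟩ => hn ?_
    rw [hm]
    exact semigroupThree_mul_mem ℓ m).toRingHom.toAlgebra

theorem coe_algebraMap_ringThree (f : k⟦X⟧) :
    (algebraMap k⟦X⟧ (ringThree k ℓ) f : k⟦X⟧) = expand 3 three_ne_zero f := rfl

/-- The element `t^ℓ` of `k[[t³, t^ℓ]]`. -/
noncomputable def ringThreeY (k : Type*) [Field k] (ℓ : ℕ) : ringThree k ℓ :=
  ⟨X ^ ℓ, X_pow_mem_semigroupRing (semigroupThree_self_mem ℓ)⟩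

theorem coe_coord_ringThree (f₀ f₁ f₂ : k⟦X⟧) :
    ((algebraMap _ (ringThree k ℓ) f₀ + algebraMap _ _ f₁ * ringThreeY k ℓ +
      algebraMap _ _ f₂ * ringThreeY k ℓ ^ 2 : ringThree k ℓ) : k⟦X⟧) =
      expand 3 three_ne_zero f₀ + expand 3 three_ne_zero f₁ * X ^ ℓ +
        expand 3 three_ne_zero f₂ * X ^ (2 * ℓ) := by
  simp only [ringThreeY, AddMemClass.coe_add, MulMemClass.coe_mul, SubmonoidClass.coe_pow,
    coe_algebraMap_ringThree]
  ring

theorem coeff_coord (f₀ f₁ f₂ : k⟦X⟧) (n : ℕ) :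
    coeff n (expand 3 three_ne_zero f₀ + expand 3 three_ne_zero f₁ * X ^ ℓ +
        expand 3 three_ne_zero f₂ * X ^ (2 * ℓ)) =
      (if 3 ∣ n then coeff (n / 3) f₀ else 0) +
        (if ℓ ≤ n ∧ 3 ∣ n - ℓ then coeff ((n - ℓ) / 3) f₁ else 0) +
        (if 2 * ℓ ≤ n ∧ 3 ∣ n - 2 * ℓ then coeff ((n - 2 * ℓ) / 3) f₂ else 0) := by
  rw [map_add, map_add, coeff_mul_X_pow', coeff_mul_X_pow']
  simp only [coeff_expand, ite_and]

/-- The coordinates of a power series collect its coefficients by residue class modulo `3`. -/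
theorem isCuspExtension_ringThree (hℓ : ¬ 3 ∣ ℓ) :
    IsCuspExtension (k := k) ℓ (ringThreeY k ℓ) where
  pow_three := by
    apply Subtype.ext
    rw [coe_algebraMap_ringThree, map_pow, expand_X]
    simp only [ringThreeY, SubmonoidClass.coe_pow]
    rw [← pow_mul, ← pow_mul, mul_comm]
  exists_coord a := by
    refine ⟨mk fun j => coeff (3 * j) (a : k⟦X⟧), mk fun j => coeff (ℓ + 3 * j) (a : k⟦X⟧),
      mk fun j => coeff (2 * ℓ + 3 * j) (a : k⟦X⟧), Subtype.ext ?_⟩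
    rw [coe_coord_ringThree]
    ext n
    rw [coeff_coord]
    simp only [coeff_mk]
    split_ifs with h0 h1 h2 h2 h1 h2 h2
    · omega
    · omega
    · omega
    · rw [Nat.mul_div_cancel' h0, add_zero, add_zero]
    · omega
    · rw [Nat.mul_div_cancel' h1.2, Nat.add_sub_cancel' h1.1, add_zero, zero_add]
    · rw [Nat.mul_div_cancel' h2.2, Nat.add_sub_cancel' h2.1, add_zero, zero_add]
    · rw [a.2 n fun hn => (mem_semigroupThree_imp hn).elim h0 fun h => h.elim h1 h2, add_zero,
        add_zero]
  coord_eq_zero f₀ f₁ f₂ h := by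
    have h' : ∀ n, _ := fun n => (coeff_coord (ℓ := ℓ) f₀ f₁ f₂ n).symm.trans (by
      rw [← coe_coord_ringThree, h, ZeroMemClass.coe_zero, map_zero])
    refine ⟨?_, ?_, ?_⟩ <;> ext j
    · have := h' (3 * j)
      rwa [if_pos (by omega), if_neg (by omega), if_neg (by omega), add_zero, add_zero,
        Nat.mul_div_cancel_left _ three_pos] at this
    · have := h' (ℓ + 3 * j)
      rwa [if_neg (by omega), if_pos (by omega), if_neg (by omega), add_zero, zero_add,
        Nat.add_sub_cancel_left, Nat.mul_div_cancel_left _ three_pos] at this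
    · have := h' (2 * ℓ + 3 * j)
      rwa [if_neg (by omega), if_neg (by omega), if_pos (by omega), add_zero, zero_add,
        Nat.add_sub_cancel_left, Nat.mul_div_cancel_left _ three_pos] at this
  X_mem := by
    rw [IsLocalRing.mem_maximalIdeal, mem_nonunits_iff]
    intro hu
    have : IsUnit (algebraMap k⟦X⟧ (ringThree k ℓ) X : k⟦X⟧) := hu.map (ringThree k ℓ).subtype
    rw [coe_algebraMap_ringThree, expand_X, isUnit_iff_not_X_dvd] at this
    exact this (dvd_pow_self X three_ne_zero)

/-! ### The two families of normal forms -/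

local notation "ι" => algebraMap k⟦X⟧ (ringThree k ℓ)

theorem coe_algebraMap_ofFin {n : ℕ} (α : Fin n → k) :
    (ι (ofFin α) : k⟦X⟧) = ∑ j : Fin n, C (α j) * X ^ (3 * (j : ℕ)) := by
  rw [coe_algebraMap_ringThree, ofFin, map_sum]
  simp only [map_mul, map_pow, expand_C, expand_X, ← pow_mul]

theorem firstIdeal_eq_span {c d q : ℕ} (hd : 3 ∣ ℓ + d) (hc : ℓ + d = 3 * c) (α : Fin q → k) :
    firstIdeal k ℓ d q hd α =
      Ideal.span {ringThreeY k ℓ - ι (-X ^ c * ofFin α), ι (X ^ (c + q))} := by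
  rw [firstIdeal]
  congr 2
  · apply Subtype.ext
    rw [neg_mul, map_neg, sub_neg_eq_add, map_mul]
    simp only [AddMemClass.coe_add, MulMemClass.coe_mul, coe_algebraMap_ofFin]
    rw [coe_algebraMap_ringThree, map_pow, expand_X, ← pow_mul, ← hc, Finset.mul_sum, ringThreeY]
    refine congrArg _ (Finset.sum_congr rfl fun j _ => ?_)
    rw [pow_add _ (ℓ + d)]
    ring
  · congr 1
    apply Subtype.ext
    rw [coe_algebraMap_ringThree, map_pow, expand_X, ← pow_mul]
    exact congrArg (X ^ ·) (by omega)

theorem secondIdeal_eq_span {q : ℕ} (p : SecondParam k q) {v : k⟦X⟧} (hv : ofFin p.α * v = 1) :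
    secondIdeal k ℓ p =
      Ideal.span {ringThreeY k ℓ - ι (-X ^ (2 * p.i) * v), ι (X ^ (3 * p.i))} := by
  rw [← IsCuspExtension.span_X_pow_add_mul hv, secondIdeal]
  congr 2
  · apply Subtype.ext
    simp only [AddMemClass.coe_add, MulMemClass.coe_mul, coe_algebraMap_ofFin]
    rw [coe_algebraMap_ringThree, map_pow, expand_X, ← pow_mul, Finset.sum_mul, ringThreeY,
      ← mul_assoc]
    refine congrArg _ (Finset.sum_congr rfl fun j _ => ?_)
    ring
  · congr 1
    apply Subtype.ext
    rw [MulMemClass.coe_mul, coe_algebraMap_ringThree, map_pow, expand_X, ← pow_mul, ringThreeY]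
    ring

theorem SecondParam.exists_inv {q : ℕ} (p : SecondParam k q) : ∃ v, ofFin p.α * v = 1 := by
  refine IsUnit.exists_right_inv ?_
  rw [isUnit_iff_constantCoeff, constantCoeff_ofFin _ p.one_le]
  exact p.ne_zero.isUnit

theorem SecondParam.ext_of_dvd {q : ℕ} {p p' : SecondParam k q} (hi : p.i = p'.i)
    (h : X ^ p.i ∣ ofFin p.α - ofFin p'.α) : p = p' := by
  obtain ⟨i, _, _, α, _⟩ := p
  obtain ⟨i', _, _, α', _⟩ := p'
  obtain rfl : i = i' := hi
  obtain rfl : α = α' := ofFin_injective_mod h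
  rfl

theorem mem_range_firstIdeal_iff {c d q : ℕ} (hd : 3 ∣ ℓ + d) (hd2 : d ≤ 2) (hc : ℓ + d = 3 * c)
    (hq : 2 * (c + q) = ℓ) {I : Ideal (ringThree k ℓ)} :
    I ∈ Set.range (fun α : Fin q → k => firstIdeal k ℓ d q hd α) ↔
      ∃ g : k⟦X⟧, X ^ ℓ ∣ g ^ 3 ∧ I = Ideal.span {ringThreeY k ℓ - ι g, ι (X ^ (c + q))} := by
  constructor
  · rintro ⟨α, rfl⟩
    refine ⟨_, ?_, firstIdeal_eq_span hd hc α⟩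
    rw [neg_mul, neg_pow, mul_pow, ← pow_mul]
    exact ((pow_dvd_pow _ (by omega)).mul_right _).mul_left _
  · rintro ⟨g, hg, rfl⟩
    obtain ⟨f, hf⟩ : X ^ c ∣ g := by
      simpa using X_pow_dvd_pow_of_cube 1 (M := c) hg (fun v hv => by omega) one_ne_zero
    obtain ⟨α, b, hα⟩ := exists_X_pow_dvd_sub_ofFin (-f) q
    refine ⟨α, ?_⟩
    simp only [firstIdeal_eq_span hd hc]
    refine IsCuspExtension.span_pair_congr ⟨b, ?_⟩
    rw [hf, pow_add]
    linear_combination X ^ c * hα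

theorem mem_range_secondIdeal_iff {q : ℕ} (hq : ∀ i, i ≤ q ↔ 6 * i < ℓ)
    {I : Ideal (ringThree k ℓ)} :
    I ∈ Set.range (fun p : SecondParam k q => secondIdeal k ℓ p) ↔
      ∃ (i : ℕ) (u : k⟦X⟧), i ≠ 0 ∧ IsUnit u ∧ 6 * i < ℓ ∧
        I = Ideal.span {ringThreeY k ℓ - ι (X ^ (2 * i) * u), ι (X ^ (3 * i))} := by
  constructor
  · rintro ⟨p, rfl⟩
    obtain ⟨v, hv⟩ := p.exists_inv
    refine ⟨p.i, -v, (Nat.one_le_iff_ne_zero.mp p.one_le), (IsUnit.of_mul_eq_one _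
      (by rw [mul_comm]; exact hv)).neg, (hq _).mp p.le_q, ?_⟩
    simp only [secondIdeal_eq_span p hv, mul_neg, neg_mul]
  · rintro ⟨i, u, hi, hu, hil, rfl⟩
    obtain ⟨f, hf⟩ := hu.neg.exists_left_inv
    obtain ⟨α, hα⟩ := exists_X_pow_dvd_sub_ofFin f i
    have hi0 : 0 < i := Nat.pos_of_ne_zero hi
    have hα0 : α ⟨0, hi0⟩ ≠ 0 := by
      rw [← constantCoeff_ofFin α hi0]
      intro h0
      have h1 := (X_dvd_iff).mp ((dvd_pow_self X hi).trans hα)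
      rw [map_sub, h0, sub_zero] at h1
      have h2 := congrArg constantCoeff hf
      rw [map_mul, h1, zero_mul, map_one] at h2
      exact zero_ne_one h2
    let p : SecondParam k q := ⟨i, hi0, (hq i).mpr hil, α, hα0⟩
    obtain ⟨v, hv⟩ := p.exists_inv
    refine ⟨p, ?_⟩
    simp only [secondIdeal_eq_span p hv]
    refine IsCuspExtension.span_pair_congr ?_
    obtain ⟨b, hb⟩ := (X_pow_dvd_sub_iff_of_mul_eq_one hf hv).mp hα
    refine ⟨b, ?_⟩
    rw [show 3 * i = 2 * i + i by ring, pow_add]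
    linear_combination X ^ (2 * i) * hb

theorem firstIdeal_injective (hℓ : ¬ 3 ∣ ℓ) {c d q : ℕ} (hd : 3 ∣ ℓ + d) (hc : ℓ + d = 3 * c)
    (hq : 2 * (c + q) = ℓ) :
    Function.Injective (fun α : Fin q → k => firstIdeal k ℓ d q hd α) := by
  have hdvd : ∀ α : Fin q → k, X ^ (c + q) ∣ (-X ^ c * ofFin α) ^ 3 - X ^ ℓ := fun α => by
    rw [X_pow_dvd_cube_sub hℓ, neg_mul, neg_pow, mul_pow, ← pow_mul]
    exact ⟨((pow_dvd_pow _ (by omega)).mul_right _).mul_left _, by omega⟩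
  intro α β h
  simp only [firstIdeal_eq_span hd hc] at h
  have h1 := ((isCuspExtension_ringThree hℓ).span_pair_inj (hdvd α) (hdvd β) h).2
  rw [neg_mul, neg_mul, ← neg_sub', dvd_neg, ← mul_sub, pow_add,
    mul_dvd_mul_iff_left (pow_ne_zero _ X_ne_zero)] at h1
  exact ofFin_injective_mod h1

theorem X_pow_dvd_second {i : ℕ} (hℓ : ¬ 3 ∣ ℓ) (hi : 6 * i < ℓ) (v : k⟦X⟧) :
    X ^ (3 * i) ∣ (-X ^ (2 * i) * v) ^ 3 - X ^ ℓ := by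
  rw [X_pow_dvd_cube_sub hℓ, neg_mul, neg_pow, mul_pow, ← pow_mul]
  exact ⟨((pow_dvd_pow _ (by omega)).mul_right _).mul_left _, by omega⟩

theorem secondIdeal_injective (hℓ : ¬ 3 ∣ ℓ) {q : ℕ} (hq : ∀ i, i ≤ q ↔ 6 * i < ℓ) :
    Function.Injective (fun p : SecondParam k q => secondIdeal k ℓ p) := by
  intro p p' h
  obtain ⟨v, hv⟩ := p.exists_inv
  obtain ⟨v', hv'⟩ := p'.exists_inv
  simp only [secondIdeal_eq_span p hv, secondIdeal_eq_span p' hv'] at h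
  obtain ⟨h1, h2⟩ := (isCuspExtension_ringThree hℓ).span_pair_inj
    (X_pow_dvd_second hℓ ((hq _).mp p.le_q) v) (X_pow_dvd_second hℓ ((hq _).mp p'.le_q) v') h
  have hi : p.i = p'.i := by omega
  refine SecondParam.ext_of_dvd hi ((X_pow_dvd_sub_iff_of_mul_eq_one hv hv').mpr ?_)
  rwa [← hi, show 3 * p.i = 2 * p.i + p.i by ring, neg_mul, neg_mul, ← neg_sub', dvd_neg,
    ← mul_sub, pow_add, mul_dvd_mul_iff_left (pow_ne_zero _ X_ne_zero)] at h2

theorem firstIdeal_ne_secondIdeal (hℓ : ¬ 3 ∣ ℓ) {c d q q' : ℕ} (hd : 3 ∣ ℓ + d)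
    (hc : ℓ + d = 3 * c) (hq : 2 * (c + q) = ℓ) (hq' : ∀ i, i ≤ q' ↔ 6 * i < ℓ) (α : Fin q → k)
    (p : SecondParam k q') : firstIdeal k ℓ d q hd α ≠ secondIdeal k ℓ p := by
  intro h
  obtain ⟨v, hv⟩ := p.exists_inv
  rw [firstIdeal_eq_span hd hc, secondIdeal_eq_span p hv] at h
  have hi := (hq' _).mp p.le_q
  have h1 := ((isCuspExtension_ringThree hℓ).span_pair_inj (by
    rw [X_pow_dvd_cube_sub hℓ, neg_mul, neg_pow, mul_pow, ← pow_mul]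
    exact ⟨((pow_dvd_pow _ (by omega)).mul_right _).mul_left _, by omega⟩)
    (X_pow_dvd_second hℓ hi v) h).1
  omega

theorem mem_ulrichIdeals_ringThree_iff (hℓ : ¬ 3 ∣ ℓ) {I : Ideal (ringThree k ℓ)} :
    I ∈ ulrichIdeals (ringThree k ℓ) ↔
      (∃ m, 2 * m = ℓ ∧ ∃ g : k⟦X⟧, X ^ ℓ ∣ g ^ 3 ∧
        I = Ideal.span {ringThreeY k ℓ - ι g, ι (X ^ m)}) ∨
      ∃ (i : ℕ) (u : k⟦X⟧), i ≠ 0 ∧ IsUnit u ∧ 6 * i < ℓ ∧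
        I = Ideal.span {ringThreeY k ℓ - ι (X ^ (2 * i) * u), ι (X ^ (3 * i))} := by
  have : IsDomain (ringThree k ℓ) := Subalgebra.isDomain _
  have h := (isCuspExtension_ringThree (k := k) hℓ).isUlrichIdeal_iff hℓ (I := I)
  rw [ulrichIdeals, Set.mem_ofPred_eq, h]
  simp only [exists_isUnit_cube_sub_iff hℓ]
  constructor
  · rintro ⟨m, hm, g, ⟨hml, hg⟩ | ⟨i, u, hu, rfl, hi, rfl⟩, rfl⟩
    · exact Or.inl ⟨m, hml, g, hg, rfl⟩
    · exact Or.inr ⟨i, u, by omega, hu, hi, rfl⟩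
  · rintro (⟨m, hml, g, hg, rfl⟩ | ⟨i, u, hi, hu, hil, rfl⟩)
    · exact ⟨m, by rintro rfl; exact hℓ (by omega), g, Or.inl ⟨hml, hg⟩, rfl⟩
    · exact ⟨3 * i, by omega, _, Or.inr ⟨i, u, hu, rfl, hil, rfl⟩, rfl⟩

theorem ulrichIdeals_ringThree_of_odd (hℓ : ¬ 3 ∣ ℓ) (hodd : ¬ 2 ∣ ℓ) {q : ℕ}
    (hq : ∀ i, i ≤ q ↔ 6 * i < ℓ) :
    ulrichIdeals (ringThree k ℓ) = Set.range (fun p : SecondParam k q => secondIdeal k ℓ p) ∧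
      Function.Injective (fun p : SecondParam k q => secondIdeal k ℓ p) := by
  refine ⟨Set.ext fun I => ?_, secondIdeal_injective hℓ hq⟩
  rw [mem_ulrichIdeals_ringThree_iff hℓ, mem_range_secondIdeal_iff hq]
  refine or_iff_right ?_
  rintro ⟨m, rfl, -⟩
  exact hodd (dvd_mul_right 2 m)

theorem ulrichIdeals_ringThree_of_even (hℓ : ¬ 3 ∣ ℓ) {d q c : ℕ} (hd : 3 ∣ ℓ + d) (hd2 : d ≤ 2)
    (hc : ℓ + d = 3 * c) (hcq : 2 * (c + q) = ℓ) (hq : ∀ i, i ≤ q ↔ 6 * i < ℓ) :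
    ulrichIdeals (ringThree k ℓ) =
        Set.range (fun α : Fin q → k => firstIdeal k ℓ d q hd α) ∪
          Set.range (fun p : SecondParam k q => secondIdeal k ℓ p) ∧
      Function.Injective
        (Sum.elim (fun α : Fin q → k => firstIdeal k ℓ d q hd α)
          (fun p : SecondParam k q => secondIdeal k ℓ p)) := by
  refine ⟨Set.ext fun I => ?_, (firstIdeal_injective hℓ hd hc hcq).sumElim
    (secondIdeal_injective hℓ hq) fun α p => firstIdeal_ne_secondIdeal hℓ hd hc hcq hq α p⟩
  rw [mem_ulrichIdeals_ringThree_iff hℓ, Set.mem_union, mem_range_secondIdeal_iff hq,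
    mem_range_firstIdeal_iff hd hd2 hc hcq]
  refine or_congr_left ⟨?_, fun h => ⟨c + q, hcq, h⟩⟩
  rintro ⟨m, hm, h⟩
  obtain rfl : m = c + q := by omega
  exact h

end RingThree

theorem theorem3p10 (k : Type*) [Field k] (ℓ : ℕ) (hℓ : 7 ≤ ℓ) (hcop : Nat.Coprime 3 ℓ) :
    (∀ (n q : ℕ) (hn : ℓ = 3 * n + 1), Odd n → q = (n - 1) / 2 →
      ulrichIdeals (ringThree k ℓ) =
          Set.range (fun α : Fin q → k => firstIdeal k ℓ 2 q (by omega) α) ∪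
            Set.range (fun p : SecondParam k q => secondIdeal k ℓ p) ∧
        Function.Injective
          (Sum.elim (fun α : Fin q → k => firstIdeal k ℓ 2 q (by omega) α)
            (fun p : SecondParam k q => secondIdeal k ℓ p))) ∧
    (∀ n q : ℕ, ℓ = 3 * n + 1 → Even n → q = n / 2 →
      ulrichIdeals (ringThree k ℓ) = Set.range (fun p : SecondParam k q => secondIdeal k ℓ p) ∧
        Function.Injective (fun p : SecondParam k q => secondIdeal k ℓ p)) ∧
    (∀ n q : ℕ, ℓ = 3 * n + 2 → Odd n → q = (n - 1) / 2 →
      ulrichIdeals (ringThree k ℓ) = Set.range (fun p : SecondParam k q => secondIdeal k ℓ p) ∧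
        Function.Injective (fun p : SecondParam k q => secondIdeal k ℓ p)) ∧
    (∀ (n q : ℕ) (hn : ℓ = 3 * n + 2), Even n → q = n / 2 →
      ulrichIdeals (ringThree k ℓ) =
          Set.range (fun α : Fin q → k => firstIdeal k ℓ 1 q (by omega) α) ∪
            Set.range (fun p : SecondParam k q => secondIdeal k ℓ p) ∧
        Function.Injective
          (Sum.elim (fun α : Fin q → k => firstIdeal k ℓ 1 q (by omega) α)
            (fun p : SecondParam k q => secondIdeal k ℓ p))) := by
  have h3 : ¬ 3 ∣ ℓ := (Nat.Prime.coprime_iff_not_dvd Nat.prime_three).mp hcop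
  refine ⟨fun n q hn hpar hq => ?_, fun n q hn hpar hq => ?_, fun n q hn hpar hq => ?_,
    fun n q hn hpar hq => ?_⟩
  · obtain ⟨r, rfl⟩ := hpar
    exact ulrichIdeals_ringThree_of_even h3 (c := 2 * r + 2) (by omega) le_rfl (by omega)
      (by omega) fun i => by omega
  · obtain ⟨r, rfl⟩ := hpar
    exact ulrichIdeals_ringThree_of_odd h3 (by omega) fun i => by omega
  · obtain ⟨r, rfl⟩ := hpar
    exact ulrichIdeals_ringThree_of_odd h3 (by omega) fun i => by omega
  · obtain ⟨r, rfl⟩ := hpar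
    exact ulrichIdeals_ringThree_of_even h3 (c := 2 * r + 1) (by omega) one_le_two (by omega)
      (by omega) fun i => by omega
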